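/- Let $M$ be a closed manifold (compact, Hausdorff, $C^\infty$, without boundary, not necessarily connected) of dimension $n\ge 1$ with a continuous Riemannian metric $\|\cdot\|$, and let $f\colon M\to M$ be a $C^1$ local diffeomorphism: $f$ is surjective and every point of $M$ has an open neighbourhood that $f$ maps $C^1$-diffeomorphically onto an open set. For $x\in M$ and $k\ge1$ put $$\|D_xf^k\|_{\mathrm{co}}=\min_{v\in T_xM,\ \|v\|=1}\|(D_xf^k)v\| .$$ Let $\mathrm{Per}(f)$ be the set of all $p\in M$ with $f^\tau(p)=p$ for some $\tau\ge1$, let $\mathrm{Cl}(\mathrm{Per}(f))$ be its closure, and let $\Omega(f)$ be the set of all $x\in M$ such that for every neighbourhood $U$ of $x$ there is a $k\ge1$ with $f^k(U)\cap U\ne\varnothing$. Assume that $f$ is nonuniformly expanding on $\mathrm{Per}(f)$, that is, there is a $\lambda_0>0$ such that $$\limsup_{k\to+\infty}\frac1k\sum_{i=0}^{k-1}\log\|D_{f^i(x)}f\|_{\mathrm{co}}\ \ge\ \lambda_0\qquad\text{for all }x\in\mathrm{Per}(f).$$ Then there are numbers $C>0$ and $\lambda>0$ such that (1) and (2) hold: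 (1) $f$ is uniformly expanding on $\mathrm{Cl}(\mathrm{Per}(f))$: $\|(D_xf^k)v\|\ge C\|v\|\exp(k\lambda)$ for all $x\in\mathrm{Cl}(\mathrm{Per}(f))$, $v\in T_xM$ and $k\ge1$. (2) For every $f$-ergodic Borel probability measure $\mu$ on $M$ the minimal Lyapunov exponent of $f$ restricted to $\mu$, that is, the real number $\lambda_{\min}(\mu,f)$ with $$\lambda_{\min}(\mu,f)=\lim_{\ell\to+\infty}\frac1\ell\log\|D_xf^\ell\|_{\mathrm{co}}\qquad\text{for }\mu\text{-almost every }x\in M,$$ exists, and either $\lambda_{\min}(\mu,f)\le0$, or $\lambda_{\min}(\mu,f)\ge\lambda$ and $\mathrm{supp}(\mu)\subseteq\mathrm{Cl}(\mathrm{Per}(f))$. Moreover: (3) If $\mathrm{Per}(f)$ is dense in $\Omega(f)$, then $f$ is uniformly expanding on $M$: there are $C'>0$ and $\lambda'>0$ with $\|(D_xf^k)v\|\ge C'\|v\|\exp(k\lambda')$ for all $x\in M$, $v\in T_xM$ and $k\ge1$. -/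

import Mathlib

open Filter Topology MeasureTheory
open scoped Manifold ContDiff Bundle

noncomputable section

/-- The co-norm (minimum norm) `‖D_x g‖_co` of the derivative of `g` at `x`: the minimum of
`‖(D_x g) v‖` over the unit tangent vectors `v` at `x`. Norms of tangent vectors are those of the
Riemannian metric of `M`. -/
def conorm (E : Type*) [NormedAddCommGroup E] [NormedSpace ℝ E]
    {M : Type*} [TopologicalSpace M] [ChartedSpace E M]
    [Bundle.RiemannianBundle (fun x : M ↦ TangentSpace 𝓘(ℝ, E) x)] (g : M → M) (x : M) : ℝ :=
  ⨅ v : {v : TangentSpace 𝓘(ℝ, E) x // ‖v‖ = 1}, ‖mfderiv 𝓘(ℝ, E) 𝓘(ℝ, E) g x v.1‖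

/-- `f` is nonuniformly expanding on `S`: there is a `lam > 0` with
`limsup_k (1/k) ∑_{i<k} log ‖D_{f^i x} f‖_co ≥ lam` for all `x ∈ S`.
The limsup is taken in the extended reals, so that it always exists. -/
def NonuniformlyExpandingOn (E : Type*) [NormedAddCommGroup E] [NormedSpace ℝ E]
    {M : Type*} [TopologicalSpace M] [ChartedSpace E M]
    [Bundle.RiemannianBundle (fun x : M ↦ TangentSpace 𝓘(ℝ, E) x)]
    (f : M → M) (S : Set M) : Prop :=
  ∃ lam : ℝ, 0 < lam ∧ ∀ x ∈ S,
    (lam : EReal) ≤ limsup (fun k : ℕ ↦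
      (((1 / (k : ℝ)) * ∑ i ∈ Finset.range k, Real.log (conorm E f (f^[i] x)) : ℝ) : EReal)) atTop

/-- `f` expands on `S` with constants `C` and `lam`:
`‖(D_x f^k) v‖ ≥ C ‖v‖ exp (k lam)` for all `x ∈ S`, `v ∈ T_x M` and `k ≥ 1`. -/
def ExpandsOnWith (E : Type*) [NormedAddCommGroup E] [NormedSpace ℝ E]
    {M : Type*} [TopologicalSpace M] [ChartedSpace E M]
    [Bundle.RiemannianBundle (fun x : M ↦ TangentSpace 𝓘(ℝ, E) x)]
    (f : M → M) (S : Set M) (C lam : ℝ) : Prop :=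
  ∀ x ∈ S, ∀ v : TangentSpace 𝓘(ℝ, E) x, ∀ k : ℕ, 1 ≤ k →
    C * ‖v‖ * Real.exp (k * lam) ≤ ‖mfderiv 𝓘(ℝ, E) 𝓘(ℝ, E) f^[k] x v‖

/-- `f` is uniformly expanding on `S`. -/
def UniformlyExpandingOn (E : Type*) [NormedAddCommGroup E] [NormedSpace ℝ E]
    {M : Type*} [TopologicalSpace M] [ChartedSpace E M]
    [Bundle.RiemannianBundle (fun x : M ↦ TangentSpace 𝓘(ℝ, E) x)]
    (f : M → M) (S : Set M) : Prop :=
  ∃ C lam : ℝ, 0 < C ∧ 0 < lam ∧ ExpandsOnWith E f S C lam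

/-- `L` is the minimal Lyapunov exponent `λ_min(μ, f)` of `f` restricted to `μ`:
`(1/l) log ‖D_x f^l‖_co → L` for `μ`-almost every `x`. (Such an `L` is unique if `μ ≠ 0`.) -/
def IsMinLyapunovExponent (E : Type*) [NormedAddCommGroup E] [NormedSpace ℝ E]
    {M : Type*} [TopologicalSpace M] [ChartedSpace E M]
    [Bundle.RiemannianBundle (fun x : M ↦ TangentSpace 𝓘(ℝ, E) x)] [MeasurableSpace M]
    (f : M → M) (μ : Measure M) (L : ℝ) : Prop :=
  ∀ᵐ x ∂μ, Tendsto (fun l : ℕ ↦ (1 / (l : ℝ)) * Real.log (conorm E f^[l] x)) atTop (𝓝 L)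

/-- The nonwandering set `Ω(f)`: the points `x` such that every neighbourhood `U` of `x` meets
`f^k(U)` for some `k ≥ 1`. -/
def nonwanderingSet {X : Type*} [TopologicalSpace X] (f : X → X) : Set X :=
  {x | ∀ U ∈ 𝓝 x, ∃ k : ℕ, 1 ≤ k ∧ (f^[k] '' U ∩ U).Nonempty}

end

/-! Write `φ = log ‖Df‖_co`. By compactness `f` has inverse branches of uniform size with Lipschitz
constant about `exp (-φ)`, and Birkhoff sums of `φ` bound `log ‖Df^n‖_co` from below. On a periodic
orbit the hypothesis says exactly that the mean of `φ` over a period is at least `λ₀`. The task is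
to turn these means into one bound `S_n φ ≥ nγ - C` with `C` independent of the periodic point, for
some `0 < γ < λ₀`.

This is `HasUniformInverseBranches.exists_birkhoffSum_ge`. Put `B k = S_k φ(x) - kγ`. Between two
record times of `B` every tail of the orbit string expands at rate `γ`, so the string has a
contracting inverse branch. Strings whose ends lie near common points of a finite net can be
concatenated and closed to a periodic orbit. For consecutive records `r < r'`, `B` rises by at most
a constant; the string from `r'` to a later copy of `r` shows that a way back exists, and finiteness
of the net supplies one of bounded cost. The closed orbit has mean at least `λ₀ > γ`, so `r' - r` is
bounded, and with it the drop of `B` below its last record. Both sides of the bound are continuous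
in `x`, so it passes to the closure, giving (1).

For (2), Kingman's theorem (`BoundedSubadditive.exists_ae_tendsto`) for `-log ‖Df^n‖_co` gives the
exponent, and if it is positive, some `m` with `∫ log ‖Df^m‖_co dμ > 0`. Then a typical orbit has
unbounded records for `f^m`. Closing strings between records in the same cell puts periodic points
near any point of the support. The uniform bound holds on the support and bounds the exponent below.

For (3), the bound on the nonwandering set extends to a neighbourhood at a fixed time `N`, and every
orbit leaves this neighbourhood only a bounded number of times. -/

/-! ### Hyperbolic times, inverse branches and closing of strings. -/

section ClosingStrings

open scoped ENNReal NNReal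

variable {X : Type*} [EMetricSpace X]

/-- Around every image point `F x` there is an inverse branch of `F`, defined on the closed ball of
radius `δ` and returning `F x` to `x`, with Lipschitz constant `exp (η - φ x)`. -/
def InverseBranchesAtScale (F : X → X) (φ : X → ℝ) (η : ℝ) (δ : ℝ≥0∞) : Prop :=
  ∀ x, ∃ g : X → X, g (F x) = x ∧ (∀ u, edist u (F x) ≤ δ → F (g u) = u) ∧
    ∀ u v, edist u (F x) ≤ δ → edist v (F x) ≤ δ →
      edist (g u) (g v) ≤ ENNReal.ofReal (Real.exp (η - φ x)) * edist u v

/-- `F` expands locally at rate `φ`, up to an arbitrarily small loss: it has inverse branches with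
Lipschitz constants `exp (η - φ)` at some scale, for every `η > 0`. -/
def HasUniformInverseBranches (F : X → X) (φ : X → ℝ) : Prop :=
  ∀ η > 0, ∃ δ > 0, InverseBranchesAtScale F φ η δ

theorem InverseBranchesAtScale.mono {F : X → X} {φ : X → ℝ} {η : ℝ} {δ δ' : ℝ≥0∞}
    (h : InverseBranchesAtScale F φ η δ) (hδ : δ' ≤ δ) : InverseBranchesAtScale F φ η δ' := by
  intro x
  obtain ⟨g, h1, h2, h3⟩ := h x
  exact ⟨g, h1, fun u hu => h2 u (hu.trans hδ), fun u v hu hv => h3 u v (hu.trans hδ) (hv.trans hδ)⟩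

/-- The orbit string `x, F x, …, F^n x` expands at rate `γ` on each of its tails
(`n` is a hyperbolic time for `x`). -/
def IsExpandingString (F : X → X) (φ : X → ℝ) (γ : ℝ) (x : X) (n : ℕ) : Prop :=
  ∀ k m, k + m = n → m * γ ≤ birkhoffSum F φ m (F^[k] x)

/-- One-step branches can be composed backwards because every tail expands at rate `γ ≥ η`: the
branch built so far is 1-Lipschitz, so it stays in the `δ`-ball on which the next one is defined. -/
theorem InverseBranchesAtScale.exists_inverse_branch_iterate {F : X → X} {φ : X → ℝ} {η γ : ℝ}
    {δ : ℝ≥0∞} (h : InverseBranchesAtScale F φ η δ) (hηγ : η ≤ γ) (n : ℕ) :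
    ∀ x, IsExpandingString F φ γ x n → ∃ G : X → X, G (F^[n] x) = x ∧
      (∀ u, edist u (F^[n] x) ≤ δ → F^[n] (G u) = u) ∧
      ∀ u v, edist u (F^[n] x) ≤ δ → edist v (F^[n] x) ≤ δ → ∀ k m, k + m = n →
        edist (F^[k] (G u)) (F^[k] (G v)) ≤
          ENNReal.ofReal (Real.exp (m * η - birkhoffSum F φ m (F^[k] x))) * edist u v := by
  induction n with
  | zero =>
    intro x _
    refine ⟨id, rfl, fun _ _ => rfl, ?_⟩
    intro u v _ _ k m hkm
    obtain ⟨rfl, rfl⟩ : k = 0 ∧ m = 0 := by omega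
    simp
  | succ n ih =>
    intro x hx
    have hx' : IsExpandingString F φ γ (F x) n := by
      intro k m hkm
      have := hx (k + 1) m (by omega)
      simpa [Function.iterate_succ_apply] using this
    obtain ⟨G, hG1, hG2, hG3⟩ := ih (F x) hx'
    obtain ⟨g, hg1, hg2, hg3⟩ := h x
    simp only [Function.iterate_succ_apply] at *
    have hnear : ∀ u, edist u (F^[n] (F x)) ≤ δ → edist (G u) (F x) ≤ δ := by
      intro u hu
      have h1 := hG3 u (F^[n] (F x)) hu (by simp) 0 n (by omega)
      simp only [Function.iterate_zero, id_eq, hG1] at h1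
      refine h1.trans ?_
      have h2 := hx' 0 n (by omega)
      simp only [Function.iterate_zero, id_eq] at h2
      have h3 : Real.exp (n * η - birkhoffSum F φ n (F x)) ≤ 1 := by
        rw [Real.exp_le_one_iff]
        have : (n : ℝ) * η ≤ n * γ := by gcongr
        linarith
      calc _ ≤ 1 * edist u (F^[n] (F x)) := by
            gcongr
            exact ENNReal.ofReal_le_one.2 h3
        _ ≤ δ := by simpa using hu
    refine ⟨g ∘ G, by simp [hG1, hg1], ?_, ?_⟩
    · intro u hu
      simp only [Function.comp_apply]
      rw [hg2 _ (hnear u hu), hG2 u hu]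
    · intro u v hu hv k m hkm
      rcases k with _ | k
      · obtain rfl : m = n + 1 := by omega
        simp only [Function.iterate_zero, id_eq, Function.comp_apply]
        have h1 := hG3 u v hu hv 0 n (by omega)
        simp only [Function.iterate_zero, id_eq] at h1
        refine (hg3 _ _ (hnear u hu) (hnear v hv)).trans ?_
        calc _ ≤ ENNReal.ofReal (Real.exp (η - φ x)) *
              (ENNReal.ofReal (Real.exp (n * η - birkhoffSum F φ n (F x))) * edist u v) := by
              gcongr
          _ = _ := by
            rw [← mul_assoc, ← ENNReal.ofReal_mul (Real.exp_nonneg _), ← Real.exp_add,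
              birkhoffSum_succ']
            congr 3
            push_cast
            ring
      · simp only [Function.iterate_succ_apply, Function.comp_apply]
        rw [hg2 _ (hnear u hu), hg2 _ (hnear v hv)]
        exact hG3 u v hu hv k m (by omega)

theorem exists_fixedPoint_of_contracting_closedBall [CompleteSpace X] {G : X → X} {y : X}
    {δ : ℝ≥0∞} {θ : ℝ≥0} (hδ : δ ≠ ⊤) (hθ : θ < 1)
    (hmaps : ∀ u, edist u y ≤ δ → edist (G u) y ≤ δ)
    (hlip : ∀ u v, edist u y ≤ δ → edist v y ≤ δ → edist (G u) (G v) ≤ θ * edist u v) :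
    ∃ p, edist p y ≤ δ ∧ G p = p := by
  have hm : Set.MapsTo G (Metric.closedEBall y δ) (Metric.closedEBall y δ) := fun u hu => hmaps u hu
  have hy : edist y y ≤ δ := by simp
  obtain ⟨p, hp, hfix, -⟩ := ContractingWith.exists_fixedPoint' (K := θ)
    (Metric.isClosed_closedEBall (a := y) (r := δ)).isComplete hm
    ⟨hθ, fun u v => hlip u v u.2 v.2⟩ hy
    (by rw [edist_comm]; exact ne_top_of_le_ne_top hδ (hmaps y hy))
  exact ⟨p, hp, hfix⟩

/-- There is a contracting inverse branch of `F^N` from the `δ`-ball around `y` to the `δ`-ball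
around `x`, along which the Birkhoff sums of `φ` are at most `A`. -/
def Linked (F : X → X) (φ : X → ℝ) (δ : ℝ≥0∞) (θ : ℝ≥0) (x y : X) (N : ℕ) (A : ℝ) : Prop :=
  ∃ G : X → X, ∀ u, edist u y ≤ δ → edist (G u) x ≤ δ ∧ F^[N] (G u) = u ∧
    birkhoffSum F φ N (G u) ≤ A ∧ ∀ v, edist v y ≤ δ → edist (G u) (G v) ≤ θ * edist u v

/-- A finite net has finitely many pairs, so choosing one link for each linkable pair bounds all
their costs. The mere existence of a link, however long, thus yields one of cost at most `D`. -/
theorem Linked.exists_uniform_bound {F : X → X} {φ : X → ℝ} {δ : ℝ≥0∞} {θ : ℝ≥0}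
    (t : Finset X) : ∃ D : ℝ, ∀ a ∈ t, ∀ b ∈ t, (∃ N A, Linked F φ δ θ a b N A) →
      ∃ N A, Linked F φ δ θ a b N A ∧ A ≤ D := by
  classical
  have h : ∀ q : X × X, ∃ D : ℝ, (∃ N A, Linked F φ δ θ q.1 q.2 N A) →
      ∃ N A, Linked F φ δ θ q.1 q.2 N A ∧ A ≤ D := by
    intro q
    by_cases hq : ∃ N A, Linked F φ δ θ q.1 q.2 N A
    · obtain ⟨N, A, h⟩ := hq
      exact ⟨A, fun _ => ⟨N, A, h, le_rfl⟩⟩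
    · exact ⟨0, fun h => absurd h hq⟩
  choose D hD using h
  obtain ⟨M, hM⟩ := ((t ×ˢ t).image D).exists_le
  refine ⟨M, fun a ha b hb hab => ?_⟩
  obtain ⟨N, A, h1, h2⟩ := hD (a, b) hab
  exact ⟨N, A, h1, h2.trans (hM _ (Finset.mem_image_of_mem D (by simp [ha, hb])))⟩

theorem Linked.trans {F : X → X} {φ : X → ℝ} {δ : ℝ≥0∞} {θ : ℝ≥0} (hθ : θ < 1) {x y z : X}
    {N N' : ℕ} {A A' : ℝ} (h : Linked F φ δ θ x y N A) (h' : Linked F φ δ θ y z N' A') :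
    Linked F φ δ θ x z (N + N') (A + A') := by
  obtain ⟨G, hG⟩ := h
  obtain ⟨G', hG'⟩ := h'
  refine ⟨G ∘ G', fun u hu => ?_⟩
  obtain ⟨a1, a2, a3, a4⟩ := hG' u hu
  obtain ⟨b1, b2, b3, b4⟩ := hG _ a1
  refine ⟨b1, ?_, ?_, fun v hv => ?_⟩
  · rw [add_comm, Function.iterate_add_apply, Function.comp_apply, b2, a2]
  · rw [birkhoffSum_add, Function.comp_apply, b2]
    exact add_le_add b3 a3
  · refine (b4 _ (hG' v hv).1).trans ?_
    calc (θ : ℝ≥0∞) * edist (G' u) (G' v) ≤ 1 * (θ * edist u v) := by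
          gcongr
          · exact_mod_cast hθ.le
          · exact a4 v hv
      _ = _ := one_mul _

theorem Linked.exists_periodic [CompleteSpace X] {F : X → X} {φ : X → ℝ} {δ : ℝ≥0∞} {θ : ℝ≥0}
    (hδ : δ ≠ ⊤) (hθ : θ < 1) {x : X} {N : ℕ} {A : ℝ} (h : Linked F φ δ θ x x N A) :
    ∃ p, F^[N] p = p ∧ birkhoffSum F φ N p ≤ A := by
  obtain ⟨G, hG⟩ := h
  obtain ⟨p, hp, hfix⟩ := exists_fixedPoint_of_contracting_closedBall hδ hθ
    (fun u hu => (hG u hu).1) (fun u v hu hv => (hG u hu).2.2.2 v hv)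
  obtain ⟨-, h2, h3, -⟩ := hG p hp
  rw [hfix] at h2 h3
  exact ⟨p, h2, h3⟩

/-- Along an expanding string the inverse branch contracts by a definite factor at all times. -/
theorem InverseBranchesAtScale.exists_contracting_branch {F : X → X} {φ : X → ℝ} {γ : ℝ}
    {δ : ℝ≥0∞} (hγ : 0 < γ) (h : InverseBranchesAtScale F φ (γ / 2) δ) {x : X} {n : ℕ}
    (hx : IsExpandingString F φ γ x n) (hn : 1 ≤ n) :
    ∃ G : X → X, G (F^[n] x) = x ∧ (∀ u, edist u (F^[n] x) ≤ δ → F^[n] (G u) = u) ∧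
      (∀ u v, edist u (F^[n] x) ≤ δ → edist v (F^[n] x) ≤ δ →
        edist (G u) (G v) ≤ (Real.exp (-(γ / 2))).toNNReal * edist u v) ∧
      ∀ u, edist u (F^[n] x) ≤ δ → ∀ k ≤ n, edist (F^[k] (G u)) (F^[k] x) ≤ edist u (F^[n] x) := by
  obtain ⟨G, h1, h2, h3⟩ := h.exists_inverse_branch_iterate (by linarith : γ / 2 ≤ γ) n x hx
  refine ⟨G, h1, h2, fun u v hu hv => ?_, fun u hu k hk => ?_⟩
  · have := h3 u v hu hv 0 n (by omega)
    refine this.trans ?_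
    rw [show ((Real.exp (-(γ / 2))).toNNReal : ℝ≥0∞) = ENNReal.ofReal (Real.exp (-(γ / 2))) from rfl]
    gcongr
    have h4 := hx 0 n (by omega)
    have h5 : (1 : ℝ) ≤ n := by exact_mod_cast hn
    nlinarith
  · have := h3 u (F^[n] x) hu (by simp) k (n - k) (by omega)
    rw [h1] at this
    refine this.trans ?_
    have h4 := hx k (n - k) (by omega)
    calc _ ≤ 1 * edist u (F^[n] x) := by
          gcongr
          rw [ENNReal.ofReal_le_one, Real.exp_le_one_iff]
          have h5 : (0 : ℝ) ≤ (n - k : ℕ) := by positivity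
          nlinarith
      _ = _ := one_mul _

theorem toNNReal_exp_neg_lt_one {a : ℝ} (ha : 0 < a) : (Real.exp (-a)).toNNReal < 1 := by
  rw [← Real.toNNReal_one, Real.toNNReal_lt_toNNReal_iff one_pos]
  simpa using ha

/-- The radius up to which the ends of a string may be moved, so that a contraction by `θ` still
maps the `δ`-ball into itself. -/
theorem exists_small_radius {δ : ℝ≥0∞} (hδ : 0 < δ) (hδ' : δ ≠ ⊤) {θ : ℝ≥0} (hθ : θ < 1) :
    ∃ ε > 0, ε ≤ δ ∧ θ * (δ + ε) + ε ≤ δ := by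
  lift δ to ℝ≥0 using hδ'
  have hδ0 : 0 < δ := by exact_mod_cast hδ
  -- With `ε = (1 - θ) δ / 2` the last inequality reduces to `(1 - θ)² ≥ 0`.
  refine ⟨((1 - θ) / 2 * δ : ℝ≥0), ?_, ?_, ?_⟩
  · have : 0 < 1 - θ := tsub_pos_of_lt hθ
    exact_mod_cast (by positivity)
  · rw [ENNReal.coe_le_coe, ← NNReal.coe_le_coe]
    push_cast [NNReal.coe_sub hθ.le]
    nlinarith [θ.2, δ.2]
  · rw [← ENNReal.coe_add, ← ENNReal.coe_mul, ← ENNReal.coe_add, ENNReal.coe_le_coe,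
      ← NNReal.coe_le_coe]
    push_cast [NNReal.coe_sub hθ.le]
    have h1 : (θ : ℝ) < 1 := by exact_mod_cast hθ
    have h2 : (0 : ℝ) < δ := by exact_mod_cast hδ0
    have h3 : (0 : ℝ) ≤ θ := θ.2
    nlinarith [mul_nonneg (sq_nonneg ((θ : ℝ) - 1)) h2.le]

theorem exists_finset_cover_edist [CompactSpace X] {ε : ℝ≥0∞} (hε : 0 < ε) :
    ∃ t : Finset X, ∀ x, ∃ c ∈ t, edist x c ≤ ε := by
  obtain ⟨t, -, ht⟩ := isCompact_univ.elim_nhds_subcover (fun x : X => Metric.eball x ε)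
    (fun x _ => Metric.eball_mem_nhds x hε)
  refine ⟨t, fun x => ?_⟩
  have := ht (Set.mem_univ x)
  simp only [Set.mem_iUnion] at this
  obtain ⟨c, hc, hx⟩ := this
  exact ⟨c, hc, le_of_lt hx⟩

/-- The branch along the string follows it within `δ + ε`, so each term of the Birkhoff sum changes
by at most `κ`; `hε` leaves room to replace the ends of the string by nearby centres. -/
theorem linked_of_isExpandingString {F : X → X} {φ : X → ℝ} {γ κ : ℝ}
    {δ ε : ℝ≥0∞} (hγ : 0 < γ) (h : InverseBranchesAtScale F φ (γ / 2) (δ + ε))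
    (hε : (Real.exp (-(γ / 2))).toNNReal * (δ + ε) + ε ≤ δ)
    (hφ : ∀ a b, edist a b ≤ δ + ε → φ a ≤ φ b + κ) {x c c' : X} {n : ℕ}
    (hx : IsExpandingString F φ γ x n) (hn : 1 ≤ n) (hc : edist x c ≤ ε)
    (hc' : edist (F^[n] x) c' ≤ ε) :
    Linked F φ δ (Real.exp (-(γ / 2))).toNNReal c c' n (birkhoffSum F φ n x + n * κ) := by
  obtain ⟨G, h1, h2, h3, h4⟩ := h.exists_contracting_branch hγ hx hn
  have hb : ∀ u, edist u c' ≤ δ → edist u (F^[n] x) ≤ δ + ε := fun u hu =>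
    (edist_triangle u c' _).trans (add_le_add hu (by rwa [edist_comm]))
  refine ⟨G, fun u hu => ⟨?_, h2 u (hb u hu), ?_, fun v hv => h3 u v (hb u hu) (hb v hv)⟩⟩
  · have h5 := h3 u (F^[n] x) (hb u hu) (by simp)
    rw [h1] at h5
    calc edist (G u) c ≤ edist (G u) x + edist x c := edist_triangle _ _ _
      _ ≤ (Real.exp (-(γ / 2))).toNNReal * (δ + ε) + ε := by
        gcongr
        exact h5.trans (by gcongr; exact hb u hu)
      _ ≤ δ := hε
  · calc birkhoffSum F φ n (G u) ≤ ∑ k ∈ Finset.range n, (φ (F^[k] x) + κ) := by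
          unfold birkhoffSum
          apply Finset.sum_le_sum
          intro k hk
          exact hφ _ _ ((h4 u (hb u hu) k (Finset.mem_range.1 hk).le).trans (hb u hu))
      _ = _ := by
        rw [Finset.sum_add_distrib]
        simp [birkhoffSum]

/-- A string between two record times of `n ↦ S_n φ(x) - n γ` is expanding. -/
theorem isExpandingString_of_record {Y : Type*} {F : Y → Y} {φ : Y → ℝ} {γ : ℝ} {x : Y}
    {r r' : ℕ} (hr : r ≤ r')
    (h : ∀ k ≤ r', birkhoffSum F φ k x - k * γ ≤ birkhoffSum F φ r' x - r' * γ) :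
    IsExpandingString F φ γ (F^[r] x) (r' - r) := by
  intro k m hkm
  rw [← Function.iterate_add_apply]
  have h1 := h (k + r) (by omega)
  have h2 : r' = (k + r) + m := by omega
  rw [h2, birkhoffSum_add F φ (k + r) m x] at h1
  push_cast at h1
  linarith

/-- The last argmax is taken, so that `b` can return to its level only after time `n`. -/
theorem exists_le_argmax (b : ℕ → ℝ) (n : ℕ) :
    ∃ r ≤ n, (∀ k ≤ n, b k ≤ b r) ∧ ∀ k, r < k → k ≤ n → b k < b r := by
  classical
  obtain ⟨i, hi, hmax⟩ := Finset.exists_max_image (Finset.range (n + 1)) b ⟨0, by simp⟩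
  have hi' : i ≤ n := Nat.lt_succ_iff.1 (Finset.mem_range.1 hi)
  have hP : ∀ k ≤ n, b k ≤ b i := fun k hk => hmax k (Finset.mem_range.2 (by omega))
  let P : ℕ → Prop := fun r => ∀ k ≤ n, b k ≤ b r
  refine ⟨Nat.findGreatest P n, Nat.findGreatest_le n, Nat.findGreatest_spec (P := P) hi' hP, ?_⟩
  intro k hk hkn
  by_contra hcon
  have h1 : P (Nat.findGreatest P n) := Nat.findGreatest_spec (P := P) hi' hP
  exact Nat.findGreatest_is_greatest hk hkn fun j hj => (h1 j hj).trans (not_lt.1 hcon)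

end ClosingStrings

/-! ### Uniform growth on periodic orbits and periodic orbits near expanding ones. -/

section ClosingOrbits

open scoped ENNReal NNReal

variable {X : Type*} [EMetricSpace X] [CompactSpace X]

theorem exists_edist_le_imp_le_add {φ : X → ℝ} (hφ : Continuous φ) {κ : ℝ} (hκ : 0 < κ) :
    ∃ ρ > (0 : ℝ≥0∞), ∀ a b, edist a b ≤ ρ → φ a ≤ φ b + κ := by
  obtain ⟨ρ, hρ, h⟩ := EMetric.uniformContinuous_iff.1
    (CompactSpace.uniformContinuous_of_continuous hφ) (ENNReal.ofReal κ) (by simpa using hκ)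
  obtain ⟨ρ', h0, h1⟩ := exists_between hρ
  refine ⟨ρ', h0, fun a b hab => ?_⟩
  have h2 := h (hab.trans_lt h1)
  rw [edist_dist, ENNReal.ofReal_lt_ofReal_iff hκ, Real.dist_eq] at h2
  linarith [(abs_lt.1 h2).2]

theorem exists_forall_abs_le {Y : Type*} [TopologicalSpace Y] [CompactSpace Y] {φ : Y → ℝ}
    (hφ : Continuous φ) : ∃ K > 0, ∀ x, |φ x| ≤ K := by
  obtain ⟨K, hK⟩ := isCompact_univ.exists_bound_of_continuousOn hφ.continuousOn
  exact ⟨max K 1, by positivity, fun x => (hK x (Set.mem_univ x)).trans (le_max_left _ _)⟩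

/-- The data of a finite net of closing centres: an expanding string of length at least one links
the centres near its ends. -/
theorem HasUniformInverseBranches.exists_net {F : X → X} {φ : X → ℝ}
    (h : HasUniformInverseBranches F φ) (hφ : Continuous φ) {γ κ : ℝ} (hγ : 0 < γ) (hκ : 0 < κ) :
    ∃ (δ : ℝ≥0∞) (c : X → X) (t : Finset X), δ ≠ ⊤ ∧ (∀ x, c x ∈ t) ∧
      ∀ x n, 1 ≤ n → IsExpandingString F φ γ x n →
        Linked F φ δ (Real.exp (-(γ / 2))).toNNReal (c x) (c (F^[n] x)) n
          (birkhoffSum F φ n x + n * κ) := by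
  obtain ⟨δ₀, hδ₀, hb⟩ := h (γ / 2) (by linarith)
  obtain ⟨ρ, hρ, hc⟩ := exists_edist_le_imp_le_add hφ hκ
  set δ := min 1 (min δ₀ ρ) / 2 with hδ
  have hδ1 : min 1 (min δ₀ ρ) ≠ ⊤ := ne_top_of_le_ne_top ENNReal.one_ne_top (min_le_left _ _)
  have hδpos : 0 < δ := ENNReal.half_pos (by positivity)
  have hδtop : δ ≠ ⊤ := ne_top_of_le_ne_top hδ1 ENNReal.half_le_self
  obtain ⟨ε, hε, hεδ, hεθ⟩ := exists_small_radius hδpos hδtop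
    (toNNReal_exp_neg_lt_one (by linarith : 0 < γ / 2))
  have hsum : δ + ε ≤ min 1 (min δ₀ ρ) := (add_le_add_right hεδ δ).trans_eq (ENNReal.add_halves _)
  obtain ⟨t, ht⟩ := exists_finset_cover_edist (X := X) hε
  choose c hct hcd using ht
  refine ⟨δ, c, t, hδtop, hct, fun x n hn hx => ?_⟩
  exact linked_of_isExpandingString hγ
    (hb.mono (hsum.trans ((min_le_right _ _).trans (min_le_left _ _)))) hεθ
    (fun a b hab => hc a b (hab.trans (hsum.trans ((min_le_right _ _).trans (min_le_right _ _)))))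
    hx hn (hcd x) (hcd _)

theorem birkhoffSum_mul_of_iterate_eq {Y : Type*} {F : Y → Y} {φ : Y → ℝ} {x : Y} {τ : ℕ}
    (hτ : F^[τ] x = x) (j n : ℕ) :
    birkhoffSum F φ (j * τ + n) x = j * birkhoffSum F φ τ x + birkhoffSum F φ n x := by
  induction j with
  | zero => simp
  | succ j ih =>
    rw [show (j + 1) * τ + n = τ + (j * τ + n) by ring, birkhoffSum_add, hτ, ih]
    push_cast
    ring

/-- If all periodic orbits have mean at least `lam`, then the Birkhoff sums of periodic points grow
uniformly at every smaller positive rate. -/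
theorem HasUniformInverseBranches.exists_birkhoffSum_ge {F : X → X} {φ : X → ℝ}
    (h : HasUniformInverseBranches F φ) (hφ : Continuous φ) {lam γ : ℝ} (hγ : 0 < γ) (hγl : γ < lam)
    (hper : ∀ p N, 1 ≤ N → F^[N] p = p → N * lam ≤ birkhoffSum F φ N p) :
    ∃ C, ∀ x ∈ Function.periodicPts F, ∀ n : ℕ, n * γ - C ≤ birkhoffSum F φ n x := by
  -- Thus `lam = γ + 2κ`: one `κ` pays for the shadowing error, the other bounds the gaps between
  -- records.
  set κ := (lam - γ) / 2 with hκ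
  have hκ0 : 0 < κ := by rw [hκ]; linarith
  obtain ⟨δ, c, t, hδ, hct, hlink⟩ := h.exists_net hφ hγ hκ0
  have hθ := toNNReal_exp_neg_lt_one (by linarith : 0 < γ / 2)
  obtain ⟨D, hD⟩ := Linked.exists_uniform_bound (F := F) (φ := φ) (δ := δ)
    (θ := (Real.exp (-(γ / 2))).toNNReal) t
  obtain ⟨K₀, hK₀, hKφ⟩ := exists_forall_abs_le hφ
  set K := K₀ + γ with hK
  -- `B` moves by at most `K` per step, and `(K + D) / κ` will bound the gap between consecutive
  -- records.
  refine ⟨K * ((K + D) / κ), ?_⟩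
  rintro x ⟨τ, hτ, hτx⟩ n
  have hτx : F^[τ] x = x := hτx
  set B : ℕ → ℝ := fun k => birkhoffSum F φ k x - k * γ with hB
  have hBstep : ∀ k m : ℕ, |B (k + m) - B k| ≤ m * K := by
    intro k m
    induction m with
    | zero => simp
    | succ m ih =>
      have e : B (k + (m + 1)) - B k = (B (k + m) - B k) + (φ (F^[k + m] x) - γ) := by
        simp only [hB]
        rw [← add_assoc, birkhoffSum_succ]
        push_cast
        ring
      rw [e]
      refine (abs_add_le _ _).trans ?_
      have : |φ (F^[k + m] x) - γ| ≤ K := by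
        refine (abs_sub _ _).trans ?_
        rw [abs_of_pos hγ]
        have := hKφ (F^[k + m] x)
        linarith
      push_cast
      linarith
  set b := B τ with hb
  have hτ1 : (1 : ℝ) ≤ τ := by exact_mod_cast hτ
  have hbpos : 0 < b := by
    have := hper x τ hτ hτx
    simp only [hb, hB]
    nlinarith
  have hBper : ∀ j k : ℕ, B (j * τ + k) = j * b + B k := by
    intro j k
    simp only [hB, hb]
    rw [birkhoffSum_mul_of_iterate_eq hτx]
    push_cast
    ring
  have hFper : ∀ j k : ℕ, F^[k + j * τ] x = F^[k] x := by
    intro j k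
    rw [Function.iterate_add_apply]
    congr 1
    rw [mul_comm, Function.iterate_mul]
    exact Function.iterate_fixed hτx j
  have hB0 : B 0 = 0 := by simp [hB]
  -- Shifting by a period raises `B` by `b > 0`, so a record stays a record; `τ ≤ r` handles the
  -- times before the first period, which cannot be shifted back.
  have hrecper : ∀ r, τ ≤ r → (∀ k ≤ r, B k ≤ B r) → ∀ j : ℕ, ∀ k ≤ j * τ + r,
      B k ≤ B (j * τ + r) := by
    intro r hτr hr j
    induction j with
    | zero => simpa using hr
    | succ j ih =>
      intro k hk
      have e : B ((j + 1) * τ + r) = b + B (j * τ + r) := by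
        rw [hBper, hBper]; push_cast; ring
      rw [e]
      rcases le_or_gt τ k with hk' | hk'
      · have e2 : B k = b + B (k - τ) := by
          have := hBper 1 (k - τ)
          rw [one_mul, Nat.add_sub_cancel' hk'] at this
          rw [this]; push_cast; ring
        rw [e2]
        have := ih (k - τ) (by rw [add_mul] at hk; omega)
        linarith
      · have := ih k (by omega)
        linarith
  -- consecutive records after time `τ` are at bounded distance
  have hgap : ∀ r r', τ ≤ r → r < r' → (∀ k ≤ r, B k ≤ B r) → (∀ k ≤ r', B k ≤ B r') →
      B r' - B r ≤ K → ((r' - r : ℕ) : ℝ) ≤ (K + D) / κ := by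
    intro r r' hτr hrr' hr hr' hdiff
    have h1 := hlink (F^[r] x) (r' - r) (by omega) (isExpandingString_of_record hrr'.le hr')
    have hr'τ : r' < r' * τ + r := by nlinarith
    -- The time `r' * τ + r` revisits the point `F^[r] x`, so this string links back to the start.
    -- Its length is uncontrolled; only the existence of the link is used, and `hD` replaces it by
    -- one of cost at most `D`.
    have h2 := hlink (F^[r'] x) (r' * τ + r - r') (by omega)
      (isExpandingString_of_record hr'τ.le (hrecper r hτr hr r'))
    rw [← Function.iterate_add_apply, Nat.sub_add_cancel hrr'.le] at h1
    rw [← Function.iterate_add_apply, Nat.sub_add_cancel hr'τ.le, add_comm (r' * τ) r, hFper] at h2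
    obtain ⟨N, A, h3, hA⟩ := hD _ (hct _) _ (hct _) ⟨_, _, h2⟩
    obtain ⟨p, hp, hsum⟩ := (h1.trans hθ h3).exists_periodic hδ hθ
    have h4 := hper p _ (by omega) hp
    have h5 : birkhoffSum F φ (r' - r) (F^[r] x) = B r' - B r + (r' - r : ℕ) * γ := by
      have := birkhoffSum_add F φ r (r' - r) x
      rw [Nat.add_sub_cancel' hrr'.le] at this
      simp only [hB]
      rw [this]
      push_cast [Nat.cast_sub hrr'.le]
      ring
    rw [le_div_iff₀ hκ0]
    push_cast at h4
    have h6 : (0 : ℝ) ≤ N * lam := by have : 0 < lam := by linarith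
                                      positivity
    have h7 : lam = γ + 2 * κ := by rw [hκ]; ring
    nlinarith
  -- Up to time `τ` the values of `B` are at most `τ * K`; starting `j` periods later forces the
  -- last maximum past `τ`, as `hgap` requires.
  obtain ⟨j, hj⟩ := exists_nat_gt (τ * K / b)
  have hjb : τ * K < B (j * τ) := by
    have := hBper j 0
    rw [add_zero, hB0, add_zero] at this
    rw [this]
    rwa [div_lt_iff₀ hbpos] at hj
  obtain ⟨r, hrn, hrmax, hrlast⟩ := exists_le_argmax B (j * τ + n)
  have hBm : B (j * τ) ≤ B r := hrmax _ (by omega)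
  have hτr : τ ≤ r := by
    by_contra hcon
    have h1 := hBstep 0 r
    rw [zero_add, hB0, sub_zero] at h1
    have h2 := le_of_abs_le h1
    have h3 : (r : ℝ) ≤ τ := by exact_mod_cast (not_le.1 hcon).le
    have h4 : (r : ℝ) * K ≤ τ * K := by gcongr
    linarith
  have hex : ∃ k, r < k ∧ B r ≤ B k := by
    refine ⟨1 * τ + r, by omega, ?_⟩
    rw [hBper]
    push_cast
    linarith
  classical
  -- `r` and `r'` are consecutive records straddling the time `j * τ + n`; just before `r'` the
  -- value of `B` is at most `B r`, so the rise is at most `K`.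
  set r' := Nat.find hex with hr'
  obtain ⟨h1, h2⟩ : r < r' ∧ B r ≤ B r' := Nat.find_spec hex
  have h3 : ∀ k, r < k → k < r' → B k < B r := by
    intro k hk hk'
    by_contra hcon
    exact Nat.find_min hex hk' ⟨hk, not_lt.1 hcon⟩
  have h4 : j * τ + n < r' := by
    by_contra hcon
    exact absurd h2 (not_le.2 (hrlast r' h1 (not_lt.1 hcon)))
  have hrec' : ∀ k ≤ r', B k ≤ B r' := by
    intro k hk
    rcases hk.eq_or_lt with rfl | hk
    · rfl
    rcases le_or_gt k r with hkr | hkr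
    · exact (hrmax k (by omega)).trans h2
    · exact (h3 k hkr hk).le.trans h2
  have hdiff : B r' - B r ≤ K := by
    have h5 : B (r' - 1) ≤ B r := by
      rcases (show r ≤ r' - 1 by omega).eq_or_lt with h | h
      · rw [← h]
      · exact (h3 _ h (by omega)).le
    have h6 := le_of_abs_le (hBstep (r' - 1) 1)
    rw [Nat.sub_add_cancel (by omega)] at h6
    push_cast at h6
    linarith
  have h5 := hgap r r' hτr h1 (fun k hk => hrmax k (by omega)) hrec' hdiff
  have h6 := neg_le_of_abs_le (hBstep r (j * τ + n - r))
  rw [Nat.add_sub_cancel' hrn] at h6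
  have h7 : ((j * τ + n - r : ℕ) : ℝ) * K ≤ (K + D) / κ * K := by
    have : ((j * τ + n - r : ℕ) : ℝ) ≤ (r' - r : ℕ) := by exact_mod_cast (by omega)
    gcongr
    linarith
  have h8 := hBper j n
  have h9 := hBper j 0
  rw [add_zero, hB0] at h9
  have h10 : B n = birkhoffSum F φ n x - n * γ := rfl
  linarith

/-- If the Birkhoff sums of `z` exceed a positive linear rate by unbounded amounts, then periodic
orbits come close to the orbit of `z` at some time of any given infinite set of times. -/
theorem HasUniformInverseBranches.exists_periodic_near {F : X → X} {φ : X → ℝ}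
    (h : HasUniformInverseBranches F φ) {γ : ℝ} (hγ : 0 < γ) {z : X}
    (hz : ∀ C : ℝ, ∃ k : ℕ, C < birkhoffSum F φ k z - k * γ) {T : Set ℕ}
    (hT : ∀ N, ∃ t ∈ T, N ≤ t) {ρ : ℝ≥0∞} (hρ : 0 < ρ) :
    ∃ t ∈ T, ∃ p ∈ Function.periodicPts F, edist p (F^[t] z) ≤ ρ := by
  obtain ⟨δ₀, hδ₀, hb⟩ := h (γ / 2) (by linarith)
  have hθ := toNNReal_exp_neg_lt_one (by linarith : 0 < γ / 2)
  set δ := min 1 (min δ₀ ρ) with hδ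
  have hδpos : 0 < δ := by positivity
  have hδtop : δ ≠ ⊤ := ne_top_of_le_ne_top ENNReal.one_ne_top (min_le_left _ _)
  obtain ⟨ε, hε, hεδ, hεθ⟩ := exists_small_radius hδpos hδtop hθ
  obtain ⟨t, ht⟩ := exists_finset_cover_edist (X := X) (ENNReal.half_pos hε.ne')
  choose c hct hcd using ht
  set B : ℕ → ℝ := fun k => birkhoffSum F φ k z - k * γ with hB
  -- Since `B` is unbounded above, it has arbitrarily late records; by pigeonhole infinitely many
  -- fall in one cell of the net.
  have hrec : ∃ᶠ r in atTop, ∀ k ≤ r, B k ≤ B r := by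
    rw [frequently_atTop]
    intro N
    obtain ⟨i, -, himax, -⟩ := exists_le_argmax B N
    obtain ⟨k, hk⟩ := hz (B i)
    obtain ⟨r, hrk, hrmax, -⟩ := exists_le_argmax B k
    refine ⟨r, ?_, fun l hl => hrmax l (by omega)⟩
    by_contra hcon
    have h1 := himax r (by omega)
    have h2 := hrmax k le_rfl
    exact absurd (hk.trans_le (h2.trans h1)) (lt_irrefl _)
  have hcell : ∃ a ∈ t, ∃ᶠ r in atTop, (∀ k ≤ r, B k ≤ B r) ∧ c (F^[r] z) = a := by
    by_contra hcon
    push Not at hcon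
    have : ∀ᶠ r in atTop, ∀ a ∈ t, ¬ ((∀ k ≤ r, B k ≤ B r) ∧ c (F^[r] z) = a) := by
      rw [Filter.eventually_all_finset]
      intro a ha
      simpa using hcon a ha
    obtain ⟨r, h1, h2⟩ := (hrec.and_eventually this).exists
    exact h2 _ (hct _) ⟨h1, rfl⟩
  obtain ⟨a, -, ha⟩ := hcell
  obtain ⟨r, -, hr, hra⟩ := frequently_atTop.1 ha 0
  obtain ⟨s, hsT, hrs⟩ := hT r
  obtain ⟨r', hsr', hr', hra'⟩ := frequently_atTop.1 ha (s + 1)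
  obtain ⟨G, h1, h2, h3, h4⟩ := (hb.mono ((min_le_right 1 _).trans (min_le_left δ₀ ρ))
    ).exists_contracting_branch hγ
    (isExpandingString_of_record (r := r) (by omega) hr') (by omega)
  rw [← Function.iterate_add_apply, Nat.sub_add_cancel (by omega)] at h1 h2 h3 h4
  have hclose : edist (F^[r] z) (F^[r'] z) ≤ ε := by
    calc _ ≤ edist (F^[r] z) a + edist a (F^[r'] z) := edist_triangle _ _ _
      _ ≤ ε / 2 + ε / 2 := by
        gcongr
        · rw [← hra]; exact hcd _
        · rw [← hra', edist_comm]; exact hcd _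
      _ = ε := ENNReal.add_halves _
  obtain ⟨p, hp, hfix⟩ := exists_fixedPoint_of_contracting_closedBall hδtop hθ
    (G := G) (y := F^[r'] z) (fun u hu => by
      have h5 := h3 u (F^[r'] z) hu (by simp)
      rw [h1] at h5
      calc edist (G u) (F^[r'] z) ≤ edist (G u) (F^[r] z) + edist (F^[r] z) (F^[r'] z) :=
            edist_triangle _ _ _
        _ ≤ (Real.exp (-(γ / 2))).toNNReal * (δ + ε) + ε := by
          gcongr
          exact h5.trans (by gcongr; exact hu.trans le_self_add)
        _ ≤ δ := hεθ) h3
  have hper : F^[r' - r] p = p := by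
    have := h2 p hp
    rwa [hfix] at this
  -- `p` follows the orbit of `z` from `r` to `r'`, and `s` lies between these times.
  refine ⟨s, hsT, F^[s - r] p, ?_, ?_⟩
  · refine ⟨r' - r, by omega, ?_⟩
    rw [Function.IsPeriodicPt, Function.IsFixedPt, ← Function.iterate_add_apply, add_comm,
      Function.iterate_add_apply, hper]
  · have h5 := h4 p hp (s - r) (by omega)
    rw [hfix, ← Function.iterate_add_apply, Nat.sub_add_cancel hrs] at h5
    exact h5.trans (hp.trans ((min_le_right _ _).trans (min_le_right _ _)))

end ClosingOrbits

/-! ### Kingman's theorem for bounded cocycles over an ergodic map. -/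

section SubadditiveErgodic

variable {Ω : Type*} [MeasurableSpace Ω] {f : Ω → Ω} {μ : Measure Ω}

/-- A measurable subadditive cocycle `g` over `f` with at most linear growth `|g n| ≤ n K`. -/
structure BoundedSubadditive (f : Ω → Ω) (g : ℕ → Ω → ℝ) (K : ℝ) : Prop where
  measurable : ∀ n, Measurable (g n)
  add_le : ∀ m n x, g (m + n) x ≤ g m x + g n (f^[m] x)
  abs_le : ∀ n x, |g n x| ≤ n * K

theorem BoundedSubadditive.integrable {g : ℕ → Ω → ℝ} {K : ℝ} (hg : BoundedSubadditive f g K)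
    [IsFiniteMeasure μ] (n : ℕ) : Integrable (g n) μ :=
  Integrable.of_bound (hg.measurable n).aestronglyMeasurable (n * K)
    (Eventually.of_forall fun x => hg.abs_le n x)

theorem boundedSubadditive_birkhoffSum {φ : Ω → ℝ} {K : ℝ} (hf : Measurable f)
    (hφ : Measurable φ) (hK : ∀ x, |φ x| ≤ K) :
    BoundedSubadditive f (fun n => birkhoffSum f φ n) K where
  measurable n := by
    unfold birkhoffSum
    exact Finset.measurable_sum _ fun i _ => hφ.comp (hf.iterate i)
  add_le m n x := (birkhoffSum_add f φ m n x).le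
  abs_le n x := by
    refine (Finset.abs_sum_le_sum_abs _ _).trans ?_
    refine (Finset.sum_le_sum fun i _ => hK (f^[i] x)).trans ?_
    simp

theorem integral_birkhoffSum {φ : Ω → ℝ} (hf : MeasurePreserving f μ μ) (hφ : Measurable φ)
    (hφi : Integrable φ μ) (n : ℕ) : ∫ x, birkhoffSum f φ n x ∂μ = n * ∫ x, φ x ∂μ := by
  unfold birkhoffSum
  rw [integral_finsetSum]
  · have : ∀ i ∈ Finset.range n, ∫ x, φ (f^[i] x) ∂μ = ∫ x, φ x ∂μ := fun i _ => by
      have h := hf.iterate i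
      rw [← integral_map (φ := f^[i]) (f := φ) h.measurable.aemeasurable
        hφ.aestronglyMeasurable, h.map_eq]
    rw [Finset.sum_congr rfl this]
    simp
  · intro i _
    exact (hf.iterate i).integrable_comp_of_integrable hφi

variable [IsProbabilityMeasure μ]

/-- Splitting an orbit segment at stopping times bounded by `N`: visits to the set `A` of points
without a good stopping time cost `K + |c|` each. -/
theorem BoundedSubadditive.le_add_birkhoffSum_indicator {g : ℕ → Ω → ℝ} {K : ℝ}
    (hg : BoundedSubadditive f g K) (hK : 0 ≤ K) {c : ℝ} {N : ℕ} {A : Set Ω}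
    (hA : ∀ x ∉ A, ∃ n, 1 ≤ n ∧ n ≤ N ∧ g n x ≤ n * c) (T : ℕ) :
    ∀ x, g T x ≤ T * c + (K + |c|) * birkhoffSum f (A.indicator fun _ => (1 : ℝ)) T x
      + N * (K + |c|) := by
  have hpos : 0 ≤ K + |c| := by positivity
  have hSnn : ∀ n x, 0 ≤ birkhoffSum f (A.indicator fun _ => (1 : ℝ)) n x := fun n x =>
    Finset.sum_nonneg fun i _ => Set.indicator_nonneg (fun _ _ => zero_le_one) _
  induction T using Nat.strong_induction_on with
  | _ T ih =>
    intro x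
    rcases Nat.eq_zero_or_pos T with rfl | hT
    · have h0 := le_of_abs_le (hg.abs_le 0 x)
      have : 0 ≤ (N : ℝ) * (K + |c|) := by positivity
      simp only [birkhoffSum_zero', Nat.cast_zero, zero_mul] at *
      simpa using h0.trans this
    by_cases hx : x ∈ A
    · obtain ⟨T, rfl⟩ : ∃ S, T = 1 + S := ⟨T - 1, by omega⟩
      have h1 := hg.add_le 1 T x
      have h2 := le_of_abs_le (hg.abs_le 1 x)
      have h3 := ih T (by omega) (f x)
      rw [birkhoffSum_add]
      simp only [birkhoffSum_one, Set.indicator_of_mem hx, Function.iterate_one] at *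
      push_cast at *
      have := neg_abs_le c
      nlinarith
    · obtain ⟨n, hn1, hnN, hn⟩ := hA x hx
      rcases le_or_gt n T with hnT | hnT
      · obtain ⟨S, rfl⟩ : ∃ S, T = n + S := ⟨T - n, by omega⟩
        have h1 := hg.add_le n S x
        have h3 := ih S (by omega) (f^[n] x)
        rw [birkhoffSum_add]
        have h4 := mul_nonneg hpos (hSnn n x)
        push_cast
        nlinarith
      · have h1 := le_of_abs_le (hg.abs_le T x)
        have h2 := mul_nonneg hpos (hSnn T x)
        have h3 : (T : ℝ) * (K + |c|) ≤ N * (K + |c|) := by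
          have : (T : ℝ) ≤ N := by exact_mod_cast (by omega)
          gcongr
        have h4 : 0 ≤ (T : ℝ) * (c + |c|) := by
          have := neg_abs_le c
          have : 0 ≤ c + |c| := by linarith
          positivity
        nlinarith

/-- Lower half of the subadditive ergodic theorem. -/
theorem BoundedSubadditive.ae_eventually_lt {g : ℕ → Ω → ℝ} {K : ℝ} (hf : Ergodic f μ)
    (hg : BoundedSubadditive f g K) (hK : 0 ≤ K) {L c : ℝ}
    (hL : ∀ n : ℕ, 1 ≤ n → n * L ≤ ∫ x, g n x ∂μ) (hc : c < L) :
    ∀ᵐ x ∂μ, ∀ᶠ n : ℕ in atTop, n * c < g n x := by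
  obtain ⟨d, hcd, hdL⟩ := exists_between hc
  -- The slack `1 / (k + 1)` makes `A` backward invariant: passing from `f x` to `x` costs a
  -- constant, absorbed by going from `k` to `k + 1` at large times.
  set A : Set Ω := {x | ∃ k : ℕ, ∃ᶠ n : ℕ in atTop, g n x ≤ n * (d - 1 / ((k : ℝ) + 1))} with hA
  have hAm : MeasurableSet A := by
    have : A = ⋃ k : ℕ, ⋂ N : ℕ, ⋃ n : ℕ, ⋃ _ : N ≤ n,
        {x | g n x ≤ n * (d - 1 / ((k : ℝ) + 1))} := by
      ext x
      simp [hA, frequently_atTop]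
    rw [this]
    refine .iUnion fun k => .iInter fun N => .iUnion fun n => .iUnion fun _ => ?_
    exact measurableSet_le (hg.measurable n) measurable_const
  have hAinv : f ⁻¹' A ⊆ A := by
    rintro x ⟨k, hk⟩
    refine ⟨k + 1, ?_⟩
    rw [frequently_atTop] at hk ⊢
    intro N
    have hgap : (0 : ℝ) < 1 / ((k : ℝ) + 1) - 1 / ((k : ℝ) + 1 + 1) := by
      rw [sub_pos]
      exact one_div_lt_one_div_of_lt (by positivity) (by linarith)
    obtain ⟨N', hN'⟩ := exists_nat_gt ((K + |d| + 1) / (1 / ((k : ℝ) + 1) - 1 / ((k : ℝ) + 1 + 1)))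
    obtain ⟨n, hn, hgn⟩ := hk (max N N')
    refine ⟨1 + n, by omega, ?_⟩
    have h1 := hg.add_le 1 n x
    have h2 := le_of_abs_le (hg.abs_le 1 x)
    rw [div_lt_iff₀ hgap] at hN'
    have h3 : (N' : ℝ) ≤ n := by exact_mod_cast (le_max_right N N').trans hn
    have h4 := mul_le_mul_of_nonneg_right h3 hgap.le
    have h5 : 1 / ((k : ℝ) + 1 + 1) ≤ 1 := by
      rw [div_le_one (by positivity)]
      have : (0 : ℝ) ≤ k := by positivity
      linarith
    have h6 := neg_abs_le d
    simp only [Function.iterate_one] at h1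
    push_cast at *
    nlinarith
  have hAnull : μ A = 0 := by
    rcases hf.ae_empty_or_univ_of_preimage_ae_le' hAm.nullMeasurableSet hAinv.eventuallyLE
      (measure_ne_top _ _) with h | h
    · exact ae_eq_empty.1 h
    exfalso
    -- Points without a good stopping time up to `N`. If `A` had full measure, `μ (Q N)` would tend
    -- to zero, and splitting long orbits at stopping times would push the mean of `g` below `L`.
    set Q : ℕ → Set Ω := fun N => {x | ∃ n, 1 ≤ n ∧ n ≤ N ∧ g n x ≤ n * d}ᶜ with hQ
    have hQm : ∀ N, MeasurableSet (Q N) := fun N => by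
      have : {x | ∃ n, 1 ≤ n ∧ n ≤ N ∧ g n x ≤ n * d} =
          ⋃ n : ℕ, ⋃ _ : 1 ≤ n, ⋃ _ : n ≤ N, {x | g n x ≤ n * d} := by
        ext x
        simp only [Set.mem_ofPred_eq, Set.mem_iUnion, exists_prop]
      refine MeasurableSet.compl ?_
      rw [this]
      exact .iUnion fun n => .iUnion fun _ => .iUnion fun _ =>
        measurableSet_le (hg.measurable n) measurable_const
    have hQanti : Antitone Q := by
      intro N N' hNN'
      refine Set.compl_subset_compl.2 ?_
      rintro x ⟨n, h1, h2, h3⟩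
      exact ⟨n, h1, h2.trans hNN', h3⟩
    have hQlim : Tendsto (fun N => μ (Q N)) atTop (𝓝 (μ (⋂ N, Q N))) :=
      tendsto_measure_iInter_atTop (fun N => (hQm N).nullMeasurableSet) hQanti
        ⟨0, measure_ne_top _ _⟩
    have hQ0 : μ (⋂ N, Q N) = 0 := by
      refine measure_eq_zero_iff_ae_notMem.2 ?_
      have hxA : ∀ᵐ x ∂μ, x ∈ A := ae_eq_univ.1 h
      filter_upwards [hxA] with x hxA hxQ
      obtain ⟨k, hk⟩ := hxA
      obtain ⟨n, hn, hgn⟩ := frequently_atTop.1 hk 1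
      refine Set.mem_iInter.1 hxQ n ⟨n, hn, le_rfl, hgn.trans ?_⟩
      have : (0 : ℝ) ≤ 1 / ((k : ℝ) + 1) := by positivity
      have h2 : (0 : ℝ) ≤ n := by positivity
      nlinarith
    rw [hQ0] at hQlim
    have hpos : 0 < K + |d| + 1 := by positivity
    have hsmall : 0 < (L - d) / (2 * (K + |d| + 1)) := by
      have : 0 < L - d := by linarith
      positivity
    obtain ⟨N, hN⟩ := (hQlim.eventually (gt_mem_nhds (ENNReal.ofReal_pos.2 hsmall))).exists
    have hNreal : μ.real (Q N) < (L - d) / (2 * (K + |d| + 1)) := by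
      rw [Measure.real, ← ENNReal.ofReal_lt_ofReal_iff hsmall,
        ENNReal.ofReal_toReal (measure_ne_top _ _)]
      exact hN
    have key : ∀ T : ℕ, 1 ≤ T →
        T * L ≤ T * d + (K + |d|) * (T * μ.real (Q N)) + N * (K + |d|) := by
      intro T hT
      refine (hL T hT).trans ?_
      have hind : Integrable ((Q N).indicator fun _ => (1 : ℝ)) μ :=
        (integrable_const 1).indicator (hQm N)
      have hindm : Measurable ((Q N).indicator fun _ => (1 : ℝ)) :=
        measurable_const.indicator (hQm N)
      have hS := integral_birkhoffSum hf.toMeasurePreserving hindm hind T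
      have hSi : Integrable (birkhoffSum f ((Q N).indicator fun _ => (1 : ℝ)) T) μ :=
        (boundedSubadditive_birkhoffSum (K := 1) hf.measurable hindm (fun x => by
          by_cases hx : x ∈ Q N <;> simp [hx])).integrable T
      rw [integral_indicator_const _ (hQm N)] at hS
      calc ∫ x, g T x ∂μ ≤ ∫ x, (T * d + (K + |d|) *
            birkhoffSum f ((Q N).indicator fun _ => (1 : ℝ)) T x + N * (K + |d|)) ∂μ := by
            refine integral_mono (hg.integrable T) ?_ ?_
            · exact ((integrable_const _).add (hSi.const_mul _)).add (integrable_const _)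
            · refine hg.le_add_birkhoffSum_indicator hK (fun x hx => ?_) T
              simpa [hQ] using hx
        _ = _ := by
          have h1 : Integrable (fun x => T * d + (K + |d|) *
              birkhoffSum f ((Q N).indicator fun _ => (1 : ℝ)) T x) μ :=
            (integrable_const _).add (hSi.const_mul _)
          rw [integral_add h1 (integrable_const _), integral_add (integrable_const _) (hSi.const_mul _),
            integral_const_mul (K + |d|), hS]
          simp
    -- Visits to `Q N` use at most half of the margin `T (L - d)`; this `T` keeps the final
    -- incomplete block strictly below the other half.
    obtain ⟨T, hT⟩ := exists_nat_gt (max 1 (2 * (N * (K + |d|)) / (L - d)))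
    have hT1 : 1 < T := by exact_mod_cast (le_max_left _ _).trans_lt hT
    have hT2 := (le_max_right _ _).trans_lt hT
    have hLd : 0 < L - d := by linarith
    rw [div_lt_iff₀ hLd] at hT2
    have h1 := key T hT1.le
    have h2 : (K + |d|) * μ.real (Q N) ≤ (L - d) / 2 := by
      rw [lt_div_iff₀ (by positivity)] at hNreal
      have : 0 ≤ μ.real (Q N) := measureReal_nonneg
      nlinarith
    have h3 : (0 : ℝ) < T := by positivity
    nlinarith
  filter_upwards [measure_eq_zero_iff_ae_notMem.1 hAnull] with x hx
  obtain ⟨k, hk⟩ := exists_nat_one_div_lt (sub_pos.2 hcd)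
  have h1 : ¬ ∃ᶠ n : ℕ in atTop, g n x ≤ n * (d - 1 / ((k : ℝ) + 1)) := fun h => hx ⟨k, h⟩
  rw [not_frequently] at h1
  filter_upwards [h1] with n hn
  refine lt_of_le_of_lt ?_ (not_le.1 hn)
  gcongr
  linarith

/-- The pointwise ergodic theorem for bounded functions, lower bound. -/
theorem ae_eventually_lt_birkhoffSum {φ : Ω → ℝ} {K : ℝ} (hf : Ergodic f μ) (hφ : Measurable φ)
    (hK0 : 0 ≤ K) (hK : ∀ x, |φ x| ≤ K) {c : ℝ} (hc : c < ∫ x, φ x ∂μ) :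
    ∀ᵐ x ∂μ, ∀ᶠ n : ℕ in atTop, n * c < birkhoffSum f φ n x := by
  have hb := boundedSubadditive_birkhoffSum hf.measurable hφ hK
  refine hb.ae_eventually_lt hf hK0 (fun n _ => ?_) hc
  rw [integral_birkhoffSum hf.toMeasurePreserving hφ]
  exact Integrable.of_bound hφ.aestronglyMeasurable K (Eventually.of_forall hK)

/-- The pointwise ergodic theorem for bounded functions, upper bound. -/
theorem ae_eventually_birkhoffSum_lt {φ : Ω → ℝ} {K : ℝ} (hf : Ergodic f μ) (hφ : Measurable φ)
    (hK0 : 0 ≤ K) (hK : ∀ x, |φ x| ≤ K) {c : ℝ} (hc : ∫ x, φ x ∂μ < c) :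
    ∀ᵐ x ∂μ, ∀ᶠ n : ℕ in atTop, birkhoffSum f φ n x < n * c := by
  have h := ae_eventually_lt_birkhoffSum hf hφ.neg hK0 (fun x => by simpa using hK x)
    (c := -c) (by simpa [integral_neg] using hc)
  filter_upwards [h] with x hx
  filter_upwards [hx] with n hn
  have : birkhoffSum f (-φ) n x = -birkhoffSum f φ n x := by simp [birkhoffSum]
  rw [this] at hn
  linarith

/-- A subadditive cocycle is dominated by the averages of its `m`-th term. -/
theorem BoundedSubadditive.mul_le_birkhoffSum {g : ℕ → Ω → ℝ} {K : ℝ}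
    (hg : BoundedSubadditive f g K) (hK : 0 ≤ K) (m n : ℕ) (x : Ω) :
    m * g (n + m) x ≤ birkhoffSum f (g m) n x + 2 * (m * (m * K)) := by
  -- Summing over all `m` starting phases produces every shift of `g m`, so ergodicity of `f`
  -- suffices and `f^[m]` need not be ergodic. Extending the sum to `j = m` and removing its first
  -- or last term gives the recursion.
  set h : ℕ → Ω → ℝ := fun n x => ∑ j ∈ Finset.range m, g (n + m - j) (f^[j] x) with hh
  have hstep : ∀ n x, h (n + 1) x ≤ g m x + h n (f x) := by
    intro n x
    have e1 : ∑ j ∈ Finset.range (m + 1), g (n + 1 + m - j) (f^[j] x) =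
        h (n + 1) x + g (n + 1) (f^[m] x) := by
      rw [Finset.sum_range_succ, show n + 1 + m - m = n + 1 by omega]
    have e2 : ∑ j ∈ Finset.range (m + 1), g (n + 1 + m - j) (f^[j] x) =
        h n (f x) + g (n + 1 + m) x := by
      rw [Finset.sum_range_succ']
      simp only [hh, Function.iterate_zero, id_eq, Function.iterate_succ_apply, Nat.sub_zero]
      congr 1
      refine Finset.sum_congr rfl fun j _ => ?_
      rw [show n + 1 + m - (j + 1) = n + m - j by omega]
    have e3 := hg.add_le m (n + 1) x
    rw [show m + (n + 1) = n + 1 + m by ring] at e3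
    linarith
  have hbound : ∀ (k : ℕ) (y : Ω), k ≤ m → g k y ≤ m * K := fun k y hk =>
    (le_of_abs_le (hg.abs_le k y)).trans (by gcongr)
  have hh0 : ∀ y, h 0 y ≤ m * (m * K) := by
    intro y
    refine (Finset.sum_le_sum fun j _ => hbound _ _ (by omega)).trans ?_
    simp
  have hmain : ∀ n x, h n x ≤ birkhoffSum f (g m) n x + m * (m * K) := by
    intro n
    induction n with
    | zero => intro x; simpa using hh0 x
    | succ n ih =>
      intro x
      rw [birkhoffSum_succ']
      linarith [hstep n x, ih (f x)]
  have hlast : m * g (n + m) x ≤ m * (m * K) + h n x := by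
    have : ∀ j ∈ Finset.range m, g (n + m) x ≤ m * K + g (n + m - j) (f^[j] x) := by
      intro j hj
      have hj := Finset.mem_range.1 hj
      have h1 := hg.add_le j (n + m - j) x
      rw [show j + (n + m - j) = n + m by omega] at h1
      linarith [hbound j x hj.le]
    have := Finset.sum_le_sum this
    rw [Finset.sum_add_distrib] at this
    simpa using this
  linarith [hmain n x]

/-- **Kingman's subadditive ergodic theorem** for an ergodic measure and a bounded cocycle. -/
theorem BoundedSubadditive.exists_ae_tendsto {g : ℕ → Ω → ℝ} {K : ℝ} (hf : Ergodic f μ)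
    (hg : BoundedSubadditive f g K) (hK : 0 ≤ K) :
    ∃ L : ℝ, (∀ᵐ x ∂μ, Tendsto (fun n : ℕ => (1 / (n : ℝ)) * g n x) atTop (𝓝 L)) ∧
      ∀ c, L < c → ∃ m : ℕ, 1 ≤ m ∧ ∫ x, g m x ∂μ < m * c := by
  set S : Set ℝ := (fun n : ℕ => (1 / (n : ℝ)) * ∫ x, g n x ∂μ) '' Set.Ici 1 with hS
  have hbdd : BddBelow S := by
    refine ⟨-K, ?_⟩
    rintro _ ⟨n, hn, rfl⟩
    have hn : (1 : ℝ) ≤ n := by exact_mod_cast hn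
    have h1 : -(n * K) ≤ ∫ x, g n x ∂μ := by
      have := integral_mono (integrable_const (-(n * K))) (hg.integrable (μ := μ) n)
        (fun x => neg_le_of_abs_le (hg.abs_le n x))
      simpa using this
    simp only [one_div]
    rw [← div_eq_inv_mul, le_div_iff₀ (by linarith)]
    linarith
  have hne : S.Nonempty := ⟨_, 1, by simp, rfl⟩
  set L := sInf S with hL
  have hLle : ∀ n : ℕ, 1 ≤ n → n * L ≤ ∫ x, g n x ∂μ := by
    intro n hn
    have h1 : L ≤ (1 / (n : ℝ)) * ∫ x, g n x ∂μ := csInf_le hbdd ⟨n, hn, rfl⟩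
    have hn : (0 : ℝ) < n := by exact_mod_cast hn
    rwa [one_div, ← div_eq_inv_mul, le_div_iff₀ hn, mul_comm] at h1
  have happrox : ∀ c, L < c → ∃ m : ℕ, 1 ≤ m ∧ ∫ x, g m x ∂μ < m * c := by
    intro c hc
    obtain ⟨_, ⟨m, hm, rfl⟩, h⟩ := exists_lt_of_csInf_lt hne hc
    refine ⟨m, hm, ?_⟩
    have hm : (0 : ℝ) < m := by exact_mod_cast hm
    simp only [one_div] at h
    rwa [← div_eq_inv_mul, div_lt_iff₀ hm, mul_comm] at h
  refine ⟨L, ?_, happrox⟩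
  have hupper : ∀ c, L < c → ∀ᵐ x ∂μ, ∀ᶠ n : ℕ in atTop, g n x ≤ n * c := by
    intro c hc
    obtain ⟨d, hLd, hdc⟩ := exists_between hc
    obtain ⟨m, hm, hmd⟩ := happrox d hLd
    filter_upwards [ae_eventually_birkhoffSum_lt hf (hg.measurable m)
      (by positivity : 0 ≤ m * K) (hg.abs_le m) hmd] with x hx
    obtain ⟨N, hN⟩ := eventually_atTop.1 hx
    have hmpos : (1 : ℝ) ≤ m := by exact_mod_cast hm
    obtain ⟨N', hN'⟩ := exists_nat_gt ((m * |c| + 2 * (m * K)) / (c - d))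
    rw [div_lt_iff₀ (by linarith)] at hN'
    filter_upwards [eventually_ge_atTop (max N N' + m)] with k hk
    obtain ⟨n, rfl⟩ : ∃ n, k = n + m := ⟨k - m, by omega⟩
    have h1 := hN n (by omega)
    have h2 := hg.mul_le_birkhoffSum hK m n x
    have h3 : (N' : ℝ) ≤ n := by exact_mod_cast (by omega)
    have h4 : (N' : ℝ) * (c - d) ≤ n * (c - d) := by
      have : 0 ≤ c - d := by linarith
      gcongr
    have h5 : (m : ℝ) * g (n + m) x ≤ m * (n * d + 2 * (m * K)) := by nlinarith
    have h6 := le_of_mul_le_mul_left h5 (by linarith)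
    have h7 := neg_abs_le c
    push_cast
    nlinarith
  have hall : ∀ᵐ x ∂μ, ∀ k : ℕ, (∀ᶠ n : ℕ in atTop, g n x ≤ n * (L + 1 / ((k : ℝ) + 1))) ∧
      ∀ᶠ n : ℕ in atTop, n * (L - 1 / ((k : ℝ) + 1)) < g n x := by
    rw [ae_all_iff]
    intro k
    have hk : (0 : ℝ) < 1 / ((k : ℝ) + 1) := by positivity
    filter_upwards [hupper _ (by linarith : L < L + 1 / ((k : ℝ) + 1)),
      hg.ae_eventually_lt hf hK hLle (by linarith : L - 1 / ((k : ℝ) + 1) < L)] with x h1 h2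
    exact ⟨h1, h2⟩
  filter_upwards [hall] with x hx
  rw [Metric.tendsto_atTop']
  intro ε hε
  obtain ⟨k, hk⟩ := exists_nat_one_div_lt hε
  obtain ⟨N, hN⟩ := eventually_atTop.1 ((hx k).1.and (hx k).2)
  refine ⟨N, fun n hn => ?_⟩
  obtain ⟨h1, h2⟩ := hN n hn.le
  have hn0 : (0 : ℝ) < n := by exact_mod_cast (by omega : 0 < n)
  rw [Real.dist_eq, one_div, ← div_eq_inv_mul, abs_lt]
  constructor
  · have : L - 1 / ((k : ℝ) + 1) < g n x / n := by rwa [lt_div_iff₀ hn0, mul_comm]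
    linarith
  · have : g n x / n ≤ L + 1 / ((k : ℝ) + 1) := by rwa [div_le_iff₀ hn0, mul_comm]
    linarith

end SubadditiveErgodic

/-! ### Tangent vectors with constant local coordinates. -/

section CoordVector

variable {E : Type*} [NormedAddCommGroup E] [NormedSpace ℝ E]
    {M : Type*} [TopologicalSpace M] [ChartedSpace E M] [IsManifold 𝓘(ℝ, E) 1 M]

/-- The vector of `T_x M` with coordinates `v` in the trivialization at `x₀`. -/
noncomputable def coordVector (x₀ : M) (p : M × E) : TangentSpace 𝓘(ℝ, E) p.1 :=
  (trivializationAt E (TangentSpace 𝓘(ℝ, E)) x₀).symm p.1 p.2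

theorem coordVector_smul {x₀ x : M}
    (hx : x ∈ (trivializationAt E (TangentSpace 𝓘(ℝ, E)) x₀).baseSet) (c : ℝ) (v : E) :
    coordVector x₀ (x, c • v) = c • coordVector (E := E) x₀ (x, v) := by
  have := ((trivializationAt E (TangentSpace 𝓘(ℝ, E)) x₀).symmₗ ℝ x).map_smul c v
  rwa [Bundle.Trivialization.coe_symmₗ _ hx] at this

theorem exists_coordVector_eq {x₀ x : M}
    (hx : x ∈ (trivializationAt E (TangentSpace 𝓘(ℝ, E)) x₀).baseSet)
    (w : TangentSpace 𝓘(ℝ, E) x) : ∃ v : E, coordVector x₀ (x, v) = w :=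
  ⟨_, (trivializationAt E (TangentSpace 𝓘(ℝ, E)) x₀).symm_proj_apply ⟨x, w⟩ hx⟩

theorem continuousAt_mk_coordVector (x₀ : M) (v : E) :
    ContinuousAt (fun p : M × E =>
      (⟨p.1, coordVector x₀ p⟩ : TangentBundle 𝓘(ℝ, E) M)) (x₀, v) := by
  set e := trivializationAt E (TangentSpace 𝓘(ℝ, E)) x₀ with he
  have h0 : x₀ ∈ e.baseSet := FiberBundle.mem_baseSet_trivializationAt' x₀
  have hmem : (x₀, v) ∈ e.target := e.mem_target.2 h0
  have h1 : ContinuousAt e.toOpenPartialHomeomorph.symm (x₀, v) :=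
    e.toOpenPartialHomeomorph.continuousAt_symm hmem
  refine h1.congr ?_
  filter_upwards [e.open_target.mem_nhds hmem] with p hp
  exact (e.mk_symm (e.mem_target.1 hp) p.2).symm

end CoordVector

/-! ### The co-norm: positivity, supermultiplicativity and continuity. -/

section Conorm

variable {E : Type*} [NormedAddCommGroup E] [NormedSpace ℝ E]
    {M : Type*} [TopologicalSpace M] [ChartedSpace E M]
    [Bundle.RiemannianBundle (fun x : M ↦ TangentSpace 𝓘(ℝ, E) x)]

theorem bddBelow_norm_mfderiv (g : M → M) (x : M) :
    BddBelow (Set.range fun v : {v : TangentSpace 𝓘(ℝ, E) x // ‖v‖ = 1} ↦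
      ‖mfderiv 𝓘(ℝ, E) 𝓘(ℝ, E) g x v.1‖) :=
  ⟨0, by rintro _ ⟨v, rfl⟩; exact norm_nonneg _⟩

theorem conorm_nonneg (g : M → M) (x : M) : 0 ≤ conorm E g x :=
  Real.iInf_nonneg fun _ => norm_nonneg _

theorem conorm_mul_norm_le (g : M → M) (x : M) (v : TangentSpace 𝓘(ℝ, E) x) :
    conorm E g x * ‖v‖ ≤ ‖mfderiv 𝓘(ℝ, E) 𝓘(ℝ, E) g x v‖ := by
  rcases eq_or_ne v 0 with rfl | hv
  · rw [norm_zero, mul_zero]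
    exact norm_nonneg _
  have hv' : ‖v‖ ≠ 0 := norm_ne_zero_iff.2 hv
  have h1 : ‖‖v‖⁻¹ • v‖ = 1 := by rw [norm_smul, norm_inv, norm_norm, inv_mul_cancel₀ hv']
  have h2 : conorm E g x ≤ ‖mfderiv 𝓘(ℝ, E) 𝓘(ℝ, E) g x (‖v‖⁻¹ • v)‖ :=
    ciInf_le (bddBelow_norm_mfderiv g x) ⟨‖v‖⁻¹ • v, h1⟩
  rw [map_smul, norm_smul, norm_inv, norm_norm, ← div_eq_inv_mul,
    le_div_iff₀ (lt_of_le_of_ne (norm_nonneg v) hv'.symm)] at h2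
  exact h2

theorem le_conorm [Nontrivial E] {g : M → M} {x : M} {c : ℝ}
    (h : ∀ v : TangentSpace 𝓘(ℝ, E) x, c * ‖v‖ ≤ ‖mfderiv 𝓘(ℝ, E) 𝓘(ℝ, E) g x v‖) :
    c ≤ conorm E g x := by
  have : Nontrivial (TangentSpace 𝓘(ℝ, E) x) := inferInstanceAs (Nontrivial E)
  obtain ⟨v, hv⟩ := exists_norm_eq (TangentSpace 𝓘(ℝ, E) x) zero_le_one
  have : Nonempty {v : TangentSpace 𝓘(ℝ, E) x // ‖v‖ = 1} := ⟨⟨v, hv⟩⟩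
  refine le_ciInf fun v => ?_
  have := h v.1
  rwa [v.2, mul_one] at this

theorem conorm_comp_ge [Nontrivial E] {g h : M → M} (hg : MDifferentiable 𝓘(ℝ, E) 𝓘(ℝ, E) g)
    (hh : MDifferentiable 𝓘(ℝ, E) 𝓘(ℝ, E) h) (x : M) :
    conorm E g (h x) * conorm E h x ≤ conorm E (g ∘ h) x := by
  refine le_conorm fun v => ?_
  rw [mfderiv_comp x (hg (h x)) (hh x)]
  calc _ = conorm E g (h x) * (conorm E h x * ‖v‖) := by ring
    _ ≤ conorm E g (h x) * ‖mfderiv 𝓘(ℝ, E) 𝓘(ℝ, E) h x v‖ :=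
      mul_le_mul_of_nonneg_left (conorm_mul_norm_le h x v) (conorm_nonneg _ _)
    _ ≤ _ := conorm_mul_norm_le g (h x) _

theorem conorm_pos [FiniteDimensional ℝ E] [Nontrivial E] {f : M → M} {x : M}
    (hf : IsLocalDiffeomorphAt 𝓘(ℝ, E) 𝓘(ℝ, E) 1 f x) : 0 < conorm E f x := by
  set e := hf.mfderivToContinuousLinearEquiv one_ne_zero with he
  have hpos : 0 < (‖(e.symm : TangentSpace 𝓘(ℝ, E) (f x) →L[ℝ] TangentSpace 𝓘(ℝ, E) x)‖ + 1)⁻¹ := by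
    positivity
  refine hpos.trans_le (le_conorm fun v => ?_)
  have h1 : mfderiv 𝓘(ℝ, E) 𝓘(ℝ, E) f x v = e v := by
    rw [← hf.mfderivToContinuousLinearEquiv_coe one_ne_zero]; rfl
  rw [h1, inv_mul_le_iff₀ (by positivity)]
  calc ‖v‖ = ‖e.symm (e v)‖ := by simp
    _ ≤ ‖(e.symm : TangentSpace 𝓘(ℝ, E) (f x) →L[ℝ] TangentSpace 𝓘(ℝ, E) x)‖ * ‖e v‖ :=
      (e.symm : TangentSpace 𝓘(ℝ, E) (f x) →L[ℝ] TangentSpace 𝓘(ℝ, E) x).le_opNorm (e v)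
    _ ≤ _ := by gcongr; linarith

variable [IsManifold 𝓘(ℝ, E) 1 M]
  [IsContinuousRiemannianBundle E (fun x : M ↦ TangentSpace 𝓘(ℝ, E) x)]

theorem continuous_norm_tangentBundle :
    Continuous fun w : TangentBundle 𝓘(ℝ, E) M => ‖w.2‖ := by
  have h : Continuous fun w : TangentBundle 𝓘(ℝ, E) M => inner ℝ w.2 w.2 :=
    Continuous.inner_bundle (F := E) (E := fun x : M ↦ TangentSpace 𝓘(ℝ, E) x)
      (b := fun w : TangentBundle 𝓘(ℝ, E) M => w.1) (v := fun w => w.2) (w := fun w => w.2)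
      continuous_id continuous_id
  have := h.sqrt
  simpa only [real_inner_self_eq_norm_sq, Real.sqrt_sq (norm_nonneg _)] using this

/-- The strict inequality is open, the unit sphere of coordinates is compact, and homogeneity covers
the other vectors. The signs of `a` and `b` are free, so upper bounds on the derivative follow as
well. -/
theorem eventually_forall_mul_norm_le [FiniteDimensional ℝ E] {f : M → M}
    (hf : ContMDiff 𝓘(ℝ, E) 𝓘(ℝ, E) 1 f) {x₀ : M} {a b : ℝ}
    (h : ∀ w : TangentSpace 𝓘(ℝ, E) x₀, w ≠ 0 →
      a * ‖w‖ < b * ‖mfderiv 𝓘(ℝ, E) 𝓘(ℝ, E) f x₀ w‖) :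
    ∀ᶠ x in 𝓝 x₀, ∀ w : TangentSpace 𝓘(ℝ, E) x,
      a * ‖w‖ ≤ b * ‖mfderiv 𝓘(ℝ, E) 𝓘(ℝ, E) f x w‖ := by
  set e := trivializationAt E (TangentSpace 𝓘(ℝ, E)) x₀ with he
  have h0 : x₀ ∈ e.baseSet := FiberBundle.mem_baseSet_trivializationAt' x₀
  have hsphere : ∀ᶠ x in 𝓝 x₀, ∀ v ∈ Metric.sphere (0 : E) 1,
      a * ‖coordVector x₀ (x, v)‖ <
        b * ‖mfderiv 𝓘(ℝ, E) 𝓘(ℝ, E) f x (coordVector x₀ (x, v))‖ := by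
    refine IsCompact.eventually_forall_of_forall_eventually (isCompact_sphere 0 1) fun v hv => ?_
    have hv0 : coordVector x₀ (x₀, v) ≠ 0 := by
      intro hcon
      have h2 := e.continuousLinearMapAt_symmL (R := ℝ) h0 v
      rw [e.symmL_apply h0, show e.symm x₀ v = 0 from hcon, map_zero] at h2
      simp [← h2] at hv
    have hc := continuousAt_mk_coordVector x₀ v
    have hA := continuous_norm_tangentBundle.continuousAt.comp hc
    have hB := (continuous_norm_tangentBundle.comp
      (hf.continuous_tangentMap le_rfl)).continuousAt.comp hc
    exact (hA.const_mul a).eventually_lt (hB.const_mul b) (h _ hv0)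
  filter_upwards [hsphere, e.open_baseSet.mem_nhds h0] with x hx hxe w
  obtain ⟨u, rfl⟩ := exists_coordVector_eq hxe w
  rcases eq_or_ne u 0 with rfl | hu
  · have : coordVector x₀ (x, (0 : E)) = 0 := by
      have := coordVector_smul hxe (0 : ℝ) (0 : E)
      rwa [smul_zero, zero_smul] at this
    rw [this, map_zero, norm_zero, norm_zero, mul_zero, mul_zero]
  have hu' : 0 < ‖u‖ := norm_pos_iff.2 hu
  have e1 : u = ‖u‖ • (‖u‖⁻¹ • u) := by rw [smul_smul, mul_inv_cancel₀ hu'.ne', one_smul]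
  have h1 := hx (‖u‖⁻¹ • u) (by simp [norm_smul, hu'.ne'])
  rw [e1, coordVector_smul hxe, map_smul, norm_smul, norm_smul, norm_norm]
  nlinarith

/-- Lower bounds persist nearby by compactness of the sphere; for upper bounds a nearly minimizing
vector is carried to nearby fibres with constant coordinates. -/
theorem continuous_conorm [FiniteDimensional ℝ E] [Nontrivial E] {f : M → M}
    (hf : ContMDiff 𝓘(ℝ, E) 𝓘(ℝ, E) 1 f) : Continuous (conorm E f) := by
  rw [continuous_iff_continuousAt]
  intro x₀
  refine tendsto_order.2 ⟨fun c hc => ?_, fun c hc => ?_⟩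
  · obtain ⟨d, hcd, hd⟩ := exists_between hc
    filter_upwards [eventually_forall_mul_norm_le hf (x₀ := x₀) (a := d) (b := 1) (fun w hw => by
      have h1 := conorm_mul_norm_le f x₀ w
      have h2 : 0 < ‖w‖ := norm_pos_iff.2 hw
      nlinarith)] with x hx
    exact hcd.trans_le (le_conorm fun v => by simpa using hx v)
  · have : Nontrivial (TangentSpace 𝓘(ℝ, E) x₀) := inferInstanceAs (Nontrivial E)
    obtain ⟨v, hv⟩ := exists_norm_eq (TangentSpace 𝓘(ℝ, E) x₀) zero_le_one
    have : Nonempty {v : TangentSpace 𝓘(ℝ, E) x₀ // ‖v‖ = 1} := ⟨⟨v, hv⟩⟩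
    obtain ⟨⟨w, hw⟩, hwc⟩ := exists_lt_of_ciInf_lt hc
    obtain ⟨u, rfl⟩ := exists_coordVector_eq
      (FiberBundle.mem_baseSet_trivializationAt' (F := E) (E := TangentSpace 𝓘(ℝ, E)) x₀) w
    have hcont : ContinuousAt (fun x : M =>
        (⟨x, coordVector x₀ (x, u)⟩ : TangentBundle 𝓘(ℝ, E) M)) x₀ :=
      (continuousAt_mk_coordVector x₀ u).comp (f := fun x : M => (x, u)) (by fun_prop)
    have hA := continuous_norm_tangentBundle.continuousAt.comp hcont
    have hB := (continuous_norm_tangentBundle.comp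
      (hf.continuous_tangentMap le_rfl)).continuousAt.comp hcont
    have hlt := hB.eventually_lt (hA.const_mul c) (by
      change ‖mfderiv 𝓘(ℝ, E) 𝓘(ℝ, E) f x₀ (coordVector x₀ (x₀, u))‖ <
        c * ‖coordVector x₀ (x₀, u)‖
      rw [hw, mul_one]
      exact hwc)
    have hApos := hA.eventually (lt_mem_nhds (show (0 : ℝ) < ‖coordVector x₀ (x₀, u)‖ by
      rw [hw]; exact one_pos))
    filter_upwards [hlt, hApos] with x h1 h2
    have h3 := conorm_mul_norm_le f x (coordVector x₀ (x, u))
    exact lt_of_mul_lt_mul_right (h3.trans_lt h1) (norm_nonneg _)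

theorem continuous_log_conorm [FiniteDimensional ℝ E] [Nontrivial E] {f : M → M}
    (hf : IsLocalDiffeomorph 𝓘(ℝ, E) 𝓘(ℝ, E) 1 f) :
    Continuous fun x => Real.log (conorm E f x) :=
  (continuous_conorm hf.contMDiff).log fun x => (conorm_pos (hf x)).ne'

theorem exists_norm_mfderiv_le [FiniteDimensional ℝ E] [CompactSpace M] {f : M → M}
    (hf : ContMDiff 𝓘(ℝ, E) 𝓘(ℝ, E) 1 f) :
    ∃ K > 0, ∀ (x : M) (v : TangentSpace 𝓘(ℝ, E) x),
      ‖mfderiv 𝓘(ℝ, E) 𝓘(ℝ, E) f x v‖ ≤ Real.exp K * ‖v‖ := by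
  have hloc : ∀ x₀ : M, ∃ C : ℝ, ∀ᶠ x in 𝓝 x₀, ∀ v : TangentSpace 𝓘(ℝ, E) x,
      ‖mfderiv 𝓘(ℝ, E) 𝓘(ℝ, E) f x v‖ ≤ C * ‖v‖ := by
    intro x₀
    refine ⟨‖mfderiv 𝓘(ℝ, E) 𝓘(ℝ, E) f x₀‖ + 1, ?_⟩
    filter_upwards [eventually_forall_mul_norm_le hf (x₀ := x₀)
      (a := -(‖mfderiv 𝓘(ℝ, E) 𝓘(ℝ, E) f x₀‖ + 1)) (b := -1) (fun w hw => by
        have h1 := (mfderiv 𝓘(ℝ, E) 𝓘(ℝ, E) f x₀).le_opNorm w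
        have h2 : 0 < ‖w‖ := norm_pos_iff.2 hw
        linarith)] with x hx v
    have := hx v
    linarith
  choose C hC using hloc
  obtain ⟨t, -, ht⟩ := isCompact_univ.elim_nhds_subcover
    (fun x₀ => {x | ∀ v : TangentSpace 𝓘(ℝ, E) x,
      ‖mfderiv 𝓘(ℝ, E) 𝓘(ℝ, E) f x v‖ ≤ C x₀ * ‖v‖}) (fun x₀ _ => hC x₀)
  classical
  obtain ⟨K, hK⟩ := (t.image C).exists_le
  refine ⟨max K 1, by positivity, fun x v => ?_⟩
  have hx := ht (Set.mem_univ x)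
  simp only [Set.mem_iUnion] at hx
  obtain ⟨x₀, hx₀, hx⟩ := hx
  refine (hx v).trans ?_
  gcongr
  have h1 := hK _ (Finset.mem_image_of_mem C hx₀)
  have h2 := Real.add_one_le_exp (max K 1)
  have h3 := le_max_left K 1
  linarith

end Conorm

/-! ### Inverse branches of local diffeomorphisms in the Riemannian distance. -/

section RiemannianBranches

open scoped ENNReal
open Manifold

variable {E : Type*} [NormedAddCommGroup E] [NormedSpace ℝ E]
    {M : Type*} [EMetricSpace M] [ChartedSpace E M]
    [Bundle.RiemannianBundle (fun x : M ↦ TangentSpace 𝓘(ℝ, E) x)]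

/-- All tangent spaces are copies of `E`, but their norms depend on the base point; this transports
norms along `f (g y) = y`. -/
theorem norm_tangentSpace_congr {a b : M} (hab : a = b) {v : TangentSpace 𝓘(ℝ, E) a}
    {w : TangentSpace 𝓘(ℝ, E) b} (hvw : (v : E) = (w : E)) : ‖v‖ = ‖w‖ := by
  subst hab
  exact congrArg norm hvw

theorem pathELength_comp_le {g : M → M} {s : Set M} {C : ℝ} (hC : 0 ≤ C)
    (hg : ∀ y ∈ s, MDifferentiableAt 𝓘(ℝ, E) 𝓘(ℝ, E) g y)
    (hgC : ∀ y ∈ s, ∀ w : TangentSpace 𝓘(ℝ, E) y,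
      ‖mfderiv 𝓘(ℝ, E) 𝓘(ℝ, E) g y w‖ ≤ C * ‖w‖)
    {c : ℝ → M} (hc : ContMDiffOn 𝓘(ℝ, ℝ) 𝓘(ℝ, E) 1 c (Set.Icc 0 1))
    (hcs : ∀ t ∈ Set.Icc (0 : ℝ) 1, c t ∈ s) :
    pathELength 𝓘(ℝ, E) (g ∘ c) 0 1 ≤ ENNReal.ofReal C * pathELength 𝓘(ℝ, E) c 0 1 := by
  rw [pathELength_eq_lintegral_mfderivWithin_Icc, pathELength_eq_lintegral_mfderivWithin_Icc,
    ← lintegral_const_mul' _ _ ENNReal.ofReal_ne_top]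
  refine setLIntegral_mono' measurableSet_Icc fun t ht => ?_
  have hcomp := mfderiv_comp_mfderivWithin (I := 𝓘(ℝ, ℝ)) t (hg (c t) (hcs t ht))
    ((hc.mdifferentiableOn one_ne_zero) t ht)
    (uniqueMDiffWithinAt_iff_uniqueDiffWithinAt.2 (uniqueDiffOn_Icc zero_lt_one t ht))
  rw [hcomp]
  have h := hgC (c t) (hcs t ht) (mfderivWithin 𝓘(ℝ, ℝ) 𝓘(ℝ, E) c (Set.Icc 0 1) t 1)
  rw [← ofReal_norm, ← ofReal_norm, ← ENNReal.ofReal_mul hC]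
  exact ENNReal.ofReal_le_ofReal h

variable [IsRiemannianManifold 𝓘(ℝ, E) M]

/-- A map whose derivative has norm at most `C` on a ball is `C`-Lipschitz on the ball of a quarter
of the radius. -/
theorem edist_map_le_of_norm_mfderiv_le {g : M → M} {y₀ : M} {ρ : ℝ≥0∞} (hρ : 0 < ρ)
    (hρ' : ρ ≠ ⊤) {C : ℝ} (hC : 0 < C)
    (hg : ∀ y, edist y y₀ < 4 * ρ → ContMDiffAt 𝓘(ℝ, E) 𝓘(ℝ, E) 1 g y)
    (hgC : ∀ y, edist y y₀ < 4 * ρ → ∀ w : TangentSpace 𝓘(ℝ, E) y,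
      ‖mfderiv 𝓘(ℝ, E) 𝓘(ℝ, E) g y w‖ ≤ C * ‖w‖) {u v : M}
    (hu : edist u y₀ ≤ ρ) (hv : edist v y₀ ≤ ρ) :
    edist (g u) (g v) ≤ ENNReal.ofReal C * edist u v := by
  have huv : edist u v < 3 * ρ := by
    calc edist u v ≤ edist u y₀ + edist y₀ v := edist_triangle _ _ _
      _ ≤ ρ + ρ := add_le_add hu (by rwa [edist_comm])
      _ = 2 * ρ := (two_mul ρ).symm
      _ < 3 * ρ := by
        rw [ENNReal.mul_lt_mul_iff_left hρ.ne' hρ']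
        norm_num
  have key : ∀ r, edist u v < r → r ≤ 3 * ρ → edist (g u) (g v) ≤ ENNReal.ofReal C * r := by
    intro r hr hr3
    rw [IsRiemannianManifold.out (I := 𝓘(ℝ, E)) u v] at hr
    obtain ⟨c, hc0, hc1, hc, hlen⟩ := exists_lt_of_riemannianEDist_lt hr
    -- A path from `u` of length below `3 * ρ` stays within `3 * ρ + ρ` of `y₀`, where the
    -- derivative bound holds.
    have hball : ∀ t ∈ Set.Icc (0 : ℝ) 1, edist (c t) y₀ < 4 * ρ := by
      intro t ht
      have h1 : edist u (c t) ≤ pathELength 𝓘(ℝ, E) c 0 1 := by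
        rw [IsRiemannianManifold.out (I := 𝓘(ℝ, E)) u (c t)]
        refine (riemannianEDist_le_pathELength (hc.mono (Set.Icc_subset_Icc_right ht.2)) hc0 rfl
          ht.1).trans ?_
        exact pathELength_mono le_rfl ht.2
      calc edist (c t) y₀ ≤ edist (c t) u + edist u y₀ := edist_triangle _ _ _
        _ < 3 * ρ + ρ := by
          refine ENNReal.add_lt_add_of_lt_of_le (ne_top_of_le_ne_top hρ' hu) ?_ hu
          rw [edist_comm]
          exact (h1.trans_lt hlen).trans_le hr3
        _ = 4 * ρ := by ring
    have h2 := pathELength_comp_le hC.le (s := {y | edist y y₀ < 4 * ρ})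
      (fun y hy => (hg y hy).mdifferentiableAt one_ne_zero) hgC hc hball
    rw [IsRiemannianManifold.out (I := 𝓘(ℝ, E)) (g u) (g v)]
    refine (riemannianEDist_le_pathELength (γ := g ∘ c) (a := 0) (b := 1) ?_ (by simp [hc0])
      (by simp [hc1]) zero_le_one).trans (h2.trans (by gcongr))
    intro t ht
    exact (hg _ (hball t ht)).comp_contMDiffWithinAt t (hc t ht)
  have hC0 : ENNReal.ofReal C ≠ 0 := by simpa using hC
  rw [mul_comm, ← ENNReal.div_le_iff_le_mul (Or.inl hC0) (Or.inl ENNReal.ofReal_ne_top)]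
  refine le_of_forall_gt_imp_ge_of_dense fun r hr => ?_
  rw [ENNReal.div_le_iff_le_mul (Or.inl hC0) (Or.inl ENNReal.ofReal_ne_top), mul_comm]
  exact (key (min r (3 * ρ)) (lt_min hr huv) (min_le_right _ _)).trans
    (by gcongr; exact min_le_left _ _)

variable [IsManifold 𝓘(ℝ, E) 1 M]
  [IsContinuousRiemannianBundle E (fun x : M ↦ TangentSpace 𝓘(ℝ, E) x)]
  [FiniteDimensional ℝ E] [Nontrivial E]

theorem exists_inverse_branches_nhds {f : M → M}
    (hf : IsLocalDiffeomorph 𝓘(ℝ, E) 𝓘(ℝ, E) 1 f) {η : ℝ} (hη : 0 < η) (x₀ : M) :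
    ∃ δ > (0 : ℝ≥0∞), ∀ᶠ x in 𝓝 x₀, ∃ g : M → M, g (f x) = x ∧
      (∀ u, edist u (f x) ≤ δ → f (g u) = u) ∧
      ∀ u v, edist u (f x) ≤ δ → edist v (f x) ≤ δ → edist (g u) (g v) ≤
        ENNReal.ofReal (Real.exp (η - Real.log (conorm E f x))) * edist u v := by
  obtain ⟨Φ, hx₀, hΦ⟩ := hf x₀
  have hcont := continuous_log_conorm hf
  set φ : M → ℝ := fun x => Real.log (conorm E f x) with hφ
  set g : M → M := Φ.invFun with hg
  have hgf : ∀ x ∈ Φ.source, g (f x) = x := fun x hx => by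
    rw [hΦ hx]; exact Φ.left_inv' hx
  have hfg : ∀ y ∈ Φ.target, f (g y) = y := fun y hy => by
    rw [hΦ (Φ.map_target' hy)]; exact Φ.right_inv' hy
  have hgsm : ∀ y ∈ Φ.target, ContMDiffAt 𝓘(ℝ, E) 𝓘(ℝ, E) 1 g y := fun y hy =>
    Φ.contMDiffOn_invFun.contMDiffAt (Φ.open_target.mem_nhds hy)
  have hy₀ : f x₀ ∈ Φ.target := by rw [hΦ hx₀]; exact Φ.map_source' hx₀
  have hlow : ∀ᶠ x in 𝓝 x₀, φ x₀ - η / 2 < φ x :=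
    hcont.continuousAt.eventually (lt_mem_nhds (by linarith))
  have hupp : ∀ᶠ x in 𝓝 x₀, φ x < φ x₀ + η / 2 :=
    hcont.continuousAt.eventually (gt_mem_nhds (by linarith))
  have hgood : {y | y ∈ Φ.target ∧ φ x₀ - η / 2 < φ (g y)} ∈ 𝓝 (f x₀) := by
    have h1 : Tendsto g (𝓝 (f x₀)) (𝓝 x₀) := by
      have := (hgsm _ hy₀).continuousAt.tendsto
      rwa [hgf x₀ hx₀] at this
    have h2 : ∀ᶠ y in 𝓝 (f x₀), y ∈ Φ.target := Φ.open_target.mem_nhds hy₀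
    exact h2.and (h1.eventually hlow)
  obtain ⟨r, hr, hball⟩ := EMetric.mem_nhds_iff.1 hgood
  set ρ : ℝ≥0∞ := min 1 r / 4 with hρdef
  have hρ1 : min 1 r ≠ ⊤ := ne_top_of_le_ne_top ENNReal.one_ne_top (min_le_left _ _)
  have hρ : 0 < ρ := ENNReal.div_pos (by positivity) (by norm_num)
  have hρ' : ρ ≠ ⊤ := ENNReal.div_ne_top hρ1 (by norm_num)
  have hρ4 : 4 * ρ ≤ r := by
    rw [hρdef, ENNReal.mul_div_cancel (by norm_num) (by norm_num)]
    exact min_le_right _ _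
  have hin : ∀ y, edist y (f x₀) < 4 * ρ → y ∈ Φ.target ∧ φ x₀ - η / 2 < φ (g y) :=
    fun y hy => hball (hy.trans_le hρ4)
  have hρlt : ρ < 4 * ρ := by
    conv_lhs => rw [← one_mul ρ]
    rw [ENNReal.mul_lt_mul_iff_left hρ.ne' hρ']
    norm_num
  -- Half of `η` covers the variation of `φ` from `x₀` to `g y`, the other half that from `x₀` to
  -- `x`.
  set C := Real.exp (η / 2 - φ x₀) with hC
  have hgC : ∀ y, edist y (f x₀) < 4 * ρ → ∀ w : TangentSpace 𝓘(ℝ, E) y,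
      ‖mfderiv 𝓘(ℝ, E) 𝓘(ℝ, E) g y w‖ ≤ C * ‖w‖ := by
    intro y hy w
    obtain ⟨hyt, hyφ⟩ := hin y hy
    have hcomp := mfderiv_comp y ((hf (g y)).mdifferentiableAt one_ne_zero)
      ((hgsm y hyt).mdifferentiableAt one_ne_zero)
    have hid : f ∘ g =ᶠ[𝓝 y] id := by
      filter_upwards [Φ.open_target.mem_nhds hyt] with z hz using hfg z hz
    have hw : ‖mfderiv 𝓘(ℝ, E) 𝓘(ℝ, E) f (g y) (mfderiv 𝓘(ℝ, E) 𝓘(ℝ, E) g y w)‖ = ‖w‖ := by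
      have h1 : mfderiv 𝓘(ℝ, E) 𝓘(ℝ, E) (f ∘ g) y w =
          mfderiv 𝓘(ℝ, E) 𝓘(ℝ, E) f (g y) (mfderiv 𝓘(ℝ, E) 𝓘(ℝ, E) g y w) := by
        rw [hcomp]; rfl
      rw [← h1]
      refine norm_tangentSpace_congr (hfg y hyt) ?_
      rw [hid.mfderiv_eq, mfderiv_id]
      rfl
    have h2 := conorm_mul_norm_le f (g y) (mfderiv 𝓘(ℝ, E) 𝓘(ℝ, E) g y w)
    rw [hw] at h2
    have h3 : Real.exp (φ x₀ - η / 2) ≤ conorm E f (g y) := by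
      rw [← Real.exp_log (conorm_pos (hf (g y)))]
      exact Real.exp_le_exp.2 hyφ.le
    have h4 : Real.exp (φ x₀ - η / 2) * ‖mfderiv 𝓘(ℝ, E) 𝓘(ℝ, E) g y w‖ ≤ ‖w‖ :=
      (mul_le_mul_of_nonneg_right h3 (norm_nonneg _)).trans h2
    have h5 : C * Real.exp (φ x₀ - η / 2) = 1 := by
      rw [hC, ← Real.exp_add]; simp
    calc ‖mfderiv 𝓘(ℝ, E) 𝓘(ℝ, E) g y w‖
        = C * (Real.exp (φ x₀ - η / 2) * ‖mfderiv 𝓘(ℝ, E) 𝓘(ℝ, E) g y w‖) := by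
          rw [← mul_assoc, h5, one_mul]
      _ ≤ C * ‖w‖ := mul_le_mul_of_nonneg_left h4 (Real.exp_nonneg _)
  refine ⟨ρ / 2, ENNReal.half_pos hρ.ne', ?_⟩
  have hfc : ∀ᶠ x in 𝓝 x₀, edist (f x) (f x₀) < ρ / 2 :=
    hf.contMDiff.continuous.continuousAt.eventually
      (Metric.eball_mem_nhds (f x₀) (ENNReal.half_pos hρ.ne'))
  filter_upwards [hupp, hfc, Φ.open_source.mem_nhds hx₀] with x hxφ hxf hxs
  have hnear : ∀ u, edist u (f x) ≤ ρ / 2 → edist u (f x₀) ≤ ρ := fun u hu =>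
    (edist_triangle u (f x) _).trans ((add_le_add hu hxf.le).trans_eq (ENNReal.add_halves _))
  refine ⟨g, hgf x hxs, fun u hu => hfg u (hin u ((hnear u hu).trans_lt hρlt)).1,
    fun u v hu hv => ?_⟩
  refine (edist_map_le_of_norm_mfderiv_le hρ hρ' (Real.exp_pos _)
    (fun y hy => hgsm y (hin y hy).1) hgC (hnear u hu) (hnear v hv)).trans ?_
  have hCx : C ≤ Real.exp (η - φ x) := Real.exp_le_exp.2 (by linarith)
  exact mul_le_mul_left (ENNReal.ofReal_le_ofReal hCx) _

/-- A local diffeomorphism of a compact Riemannian manifold expands locally at the rate given by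
the co-norm of its derivative. -/
theorem hasUniformInverseBranches_log_conorm [CompactSpace M] {f : M → M}
    (hf : IsLocalDiffeomorph 𝓘(ℝ, E) 𝓘(ℝ, E) 1 f) :
    HasUniformInverseBranches f fun x => Real.log (conorm E f x) := by
  intro η hη
  choose δ hδ h using exists_inverse_branches_nhds hf hη
  obtain ⟨t, -, ht⟩ := isCompact_univ.elim_nhds_subcover _ (fun x₀ _ => h x₀)
  refine ⟨t.inf δ, (Finset.lt_inf_iff ENNReal.zero_lt_top).2 fun x₀ _ => hδ x₀, fun x => ?_⟩
  have hx := ht (Set.mem_univ x)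
  simp only [Set.mem_iUnion] at hx
  obtain ⟨x₀, hx₀, g, h1, h2, h3⟩ := hx
  have hle : t.inf δ ≤ δ x₀ := Finset.inf_le hx₀
  exact ⟨g, h1, fun u hu => h2 u (hu.trans hle),
    fun u v hu hv => h3 u v (hu.trans hle) (hv.trans hle)⟩

end RiemannianBranches

/-! ### Supports of expanding ergodic measures. -/

section PeriodicApproximation

open scoped ENNReal

theorem birkhoffSum_mul_eq_sum {Y : Type*} (f : Y → Y) (ψ : Y → ℝ) (m k : ℕ) (x : Y) :
    birkhoffSum f ψ (m * k) x = ∑ s ∈ Finset.range m, birkhoffSum f^[m] ψ k (f^[s] x) := by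
  induction k with
  | zero => simp
  | succ k ih =>
    rw [mul_add, mul_one, birkhoffSum_add, ih]
    simp only [birkhoffSum_succ]
    rw [Finset.sum_add_distrib]
    congr 1
    refine Finset.sum_congr rfl fun s _ => ?_
    rw [← Function.iterate_mul, ← Function.iterate_add_apply, ← Function.iterate_add_apply, add_comm]

/-- An `f`-ergodic measure need not be ergodic for `f^[m]`. An `f`-sum of length `m * k` splits into
`m` sums along `f^[m]`, so linear growth of the total forces unbounded growth in some phase `s`. -/
theorem exists_unbounded_birkhoffSum_iterate {Y : Type*} {f : Y → Y} {ψ : Y → ℝ} {m : ℕ}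
    (hm : 1 ≤ m) {c : ℝ} (hc : 0 < c) {x : Y}
    (h : ∀ᶠ n : ℕ in atTop, n * c < birkhoffSum f ψ n x) :
    ∃ s < m, ∀ C : ℝ, ∃ k : ℕ, C < birkhoffSum f^[m] ψ k (f^[s] x) - k * (c / 2) := by
  by_contra! hcon
  have hcon' : ∀ s, ∃ C : ℝ, s < m → ∀ k : ℕ,
      birkhoffSum f^[m] ψ k (f^[s] x) - k * (c / 2) ≤ C := by
    intro s
    by_cases hs : s < m
    · obtain ⟨C, hC⟩ := hcon s hs
      exact ⟨C, fun _ => hC⟩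
    · exact ⟨0, fun h => absurd h hs⟩
  choose C hC using hcon'
  obtain ⟨N, hN⟩ := eventually_atTop.1 h
  obtain ⟨k', hk'⟩ := exists_nat_gt ((∑ s ∈ Finset.range m, C s) / (c / 2))
  rw [div_lt_iff₀ (by linarith)] at hk'
  set k := max k' (max N 1) with hk
  have hmk : k ≤ m * k := Nat.le_mul_of_pos_left k hm
  have h1 := hN (m * k) (((le_max_left _ _).trans (le_max_right _ _)).trans hmk)
  rw [birkhoffSum_mul_eq_sum] at h1
  have h2 : ∑ s ∈ Finset.range m, birkhoffSum f^[m] ψ k (f^[s] x) ≤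
      ∑ s ∈ Finset.range m, (C s + k * (c / 2)) := by
    refine Finset.sum_le_sum fun s hs => ?_
    have := hC s (Finset.mem_range.1 hs) k
    linarith
  rw [Finset.sum_add_distrib, Finset.sum_const, Finset.card_range, nsmul_eq_mul] at h2
  have h3 : (k' : ℝ) ≤ (m * k : ℕ) := by exact_mod_cast (le_max_left _ _).trans hmk
  push_cast at h1 h3
  nlinarith

theorem forall_exists_ge_mem_of_birkhoffSum {Y : Type*} {f : Y → Y} {U : Set Y} {c : ℝ}
    (hc : 0 < c) {x : Y}
    (h : ∀ᶠ n : ℕ in atTop, n * c < birkhoffSum f (U.indicator fun _ => (1 : ℝ)) n x) (N : ℕ) :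
    ∃ n ≥ N, f^[n] x ∈ U := by
  by_contra! hcon
  obtain ⟨N', hN'⟩ := eventually_atTop.1 h
  obtain ⟨j, hj⟩ := exists_nat_gt (N / c)
  rw [div_lt_iff₀ hc] at hj
  have h1 := hN' (N + (j + N')) (by omega)
  rw [birkhoffSum_add] at h1
  have h2 : birkhoffSum f (U.indicator fun _ => (1 : ℝ)) (j + N') (f^[N] x) = 0 := by
    refine Finset.sum_eq_zero fun i _ => ?_
    rw [← Function.iterate_add_apply]
    exact Set.indicator_of_notMem (hcon _ (by omega)) _
  have h3 : birkhoffSum f (U.indicator fun _ => (1 : ℝ)) N x ≤ N := by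
    calc _ ≤ ∑ _i ∈ Finset.range N, (1 : ℝ) :=
          Finset.sum_le_sum fun i _ => Set.indicator_le_self' (fun _ _ => zero_le_one) _
      _ = N := by simp
  rw [h2, add_zero] at h1
  push_cast at h1
  have h4 : 0 ≤ (N + N' : ℝ) * c := by positivity
  linarith

variable {X : Type*} [EMetricSpace X] [CompactSpace X] [MeasurableSpace X] [BorelSpace X]

/-- An ergodic measure for which some iterate expands on average is supported in the closure of the
periodic points. -/
theorem HasUniformInverseBranches.support_subset_closure_periodicPts {f : X → X}
    (hfc : Continuous f) {μ : Measure X} [IsProbabilityMeasure μ] (hμ : Ergodic f μ) {m : ℕ}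
    (hm : 1 ≤ m) {ψ : X → ℝ} (hψ : Continuous ψ) (h : HasUniformInverseBranches f^[m] ψ)
    (hint : 0 < ∫ x, ψ x ∂μ) : μ.support ⊆ closure (Function.periodicPts f) := by
  intro y hy
  rw [EMetric.mem_closure_iff]
  intro ε hε
  have hε2 : 0 < ε / 2 := ENNReal.half_pos hε.ne'
  set U := Metric.eball y (ε / 2) with hU
  have hUm : MeasurableSet U := Metric.isOpen_eball.measurableSet
  have hUpos : 0 < μ U := (Measure.mem_support_iff_forall y).1 hy U (Metric.eball_mem_nhds y hε2)
  obtain ⟨K, hK0, hK⟩ := exists_forall_abs_le hψ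
  have h1 := ae_eventually_lt_birkhoffSum hμ hψ.measurable hK0.le hK (half_lt_self hint)
  have hreal : 0 < μ.real U := ENNReal.toReal_pos hUpos.ne' (measure_ne_top _ _)
  have h2 := ae_eventually_lt_birkhoffSum hμ (φ := U.indicator fun _ => (1 : ℝ)) (K := 1)
    (measurable_const.indicator hUm) zero_le_one (fun x => by by_cases hx : x ∈ U <;> simp [hx])
    (c := μ.real U / 2) (by rw [integral_indicator_const _ hUm]; simpa using hreal)
  obtain ⟨x, hx1, hx2⟩ := (h1.and h2).exists
  obtain ⟨s, hs, hz⟩ := exists_unbounded_birkhoffSum_iterate hm (half_pos hint) hx1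
  have huc : ∀ᶠ p in uniformity X, ∀ i ∈ Finset.range m, edist (f^[i] p.1) (f^[i] p.2) < ε / 2 := by
    rw [Filter.eventually_all_finset]
    intro i _
    exact (CompactSpace.uniformContinuous_of_continuous (hfc.iterate i)).eventually
      (edist_mem_uniformity hε2)
  obtain ⟨ρ₀, hρ₀, hρ⟩ := mem_uniformity_edist.1 huc
  obtain ⟨ρ, hρpos, hρlt⟩ := exists_between hρ₀
  obtain ⟨t, ⟨i, him, hiU⟩, p, ⟨k, hk, hpk⟩, hp⟩ := h.exists_periodic_near (by linarith) hz
    -- The `f`-orbit visits `U` at arbitrarily late times, but perhaps not at multiples of `m` in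
    -- phase `s`; the remainder `i < m` is undone by uniform continuity of `f^[i]`.
    (T := {t | ∃ i < m, f^[i] ((f^[m])^[t] (f^[s] x)) ∈ U}) (fun N => by
      obtain ⟨n, hn, hnU⟩ := forall_exists_ge_mem_of_birkhoffSum (half_pos hreal) hx2 (s + m * N)
      refine ⟨(n - s) / m, ⟨(n - s) % m, Nat.mod_lt _ hm, ?_⟩, ?_⟩
      · rw [← Function.iterate_mul, ← Function.iterate_add_apply, ← Function.iterate_add_apply,
          Nat.mod_add_div, Nat.sub_add_cancel (by omega)]
        exact hnU
      · rw [Nat.le_div_iff_mul_le hm, mul_comm]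
        omega) hρpos
  have hfp : f^[m * k] p = p := by rw [Function.iterate_mul]; exact hpk
  refine ⟨f^[i] p, ⟨m * k, by positivity, ?_⟩, ?_⟩
  · rw [Function.IsPeriodicPt, Function.IsFixedPt, ← Function.iterate_add_apply, add_comm,
      Function.iterate_add_apply, hfp]
  · have h3 := hρ (hp.trans_lt hρlt) i (Finset.mem_range.2 him)
    have h4 : edist (f^[i] ((f^[m])^[t] (f^[s] x))) y < ε / 2 := hiU
    calc edist y (f^[i] p) ≤ edist y (f^[i] ((f^[m])^[t] (f^[s] x)))
          + edist (f^[i] ((f^[m])^[t] (f^[s] x))) (f^[i] p) := edist_triangle _ _ _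
      _ < ε / 2 + ε / 2 := by
        rw [edist_comm] at h3 h4
        exact ENNReal.add_lt_add h4 h3
      _ = ε := ENNReal.add_halves _

end PeriodicApproximation

/-! ### Bounded time away from the nonwandering set. -/

section Wandering

variable {X : Type*} [TopologicalSpace X] [CompactSpace X]

/-- Orbits spend a uniformly bounded time outside a neighbourhood of the nonwandering set. -/
theorem exists_birkhoffSum_indicator_le {f : X → X} {U : Set X} (hU : IsOpen U)
    (hΩ : nonwanderingSet f ⊆ U) :
    ∃ P : ℕ, ∀ (T : ℕ) (x : X), birkhoffSum f (Uᶜ.indicator fun _ => (1 : ℝ)) T x ≤ P := by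
  classical
  have hw : ∀ y : X, ∃ V ∈ 𝓝 y, y ∈ Uᶜ → ∀ k : ℕ, 1 ≤ k → ¬ (f^[k] '' V ∩ V).Nonempty := by
    intro y
    by_cases hy : y ∈ Uᶜ
    · have : ¬ ∀ V ∈ 𝓝 y, ∃ k : ℕ, 1 ≤ k ∧ (f^[k] '' V ∩ V).Nonempty := fun h => hy (hΩ h)
      push Not at this
      obtain ⟨V, hV, h⟩ := this
      exact ⟨V, hV, fun _ k hk => Set.not_nonempty_iff_eq_empty.2 (h k hk)⟩
    · exact ⟨Set.univ, univ_mem, fun h => absurd h hy⟩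
  choose V hV hVw using hw
  obtain ⟨t, htU, ht⟩ := hU.isClosed_compl.isCompact.elim_nhds_subcover V (fun y _ => hV y)
  refine ⟨t.card, fun T x => ?_⟩
  have hcell : ∀ i, ∃ y, f^[i] x ∈ Uᶜ → y ∈ t ∧ f^[i] x ∈ V y := by
    intro i
    by_cases hi : f^[i] x ∈ Uᶜ
    · have := ht hi
      simp only [Set.mem_iUnion, exists_prop] at this
      obtain ⟨y, h⟩ := this
      exact ⟨y, fun _ => h⟩
    · exact ⟨x, fun h => absurd h hi⟩
  choose y hy using hcell
  -- No orbit meets a wandering neighbourhood twice, so assigning visits to cells is injective.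
  have hcard : ((Finset.range T).filter fun i => f^[i] x ∈ Uᶜ).card ≤ t.card := by
    refine Finset.card_le_card_of_injOn y (fun i hi => ?_) ?_
    · exact (hy i (Finset.mem_filter.1 hi).2).1
    · have aux : ∀ i j, i < j → f^[i] x ∈ Uᶜ → f^[j] x ∈ Uᶜ → y i ≠ y j := by
        intro i j hij hi hj he
        obtain ⟨hit, hiV⟩ := hy i hi
        obtain ⟨-, hjV⟩ := hy j hj
        refine hVw (y i) (htU _ hit) (j - i) (by omega) ⟨f^[j] x, ⟨f^[i] x, hiV, ?_⟩, he ▸ hjV⟩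
        rw [← Function.iterate_add_apply, Nat.sub_add_cancel hij.le]
      intro i hi j hj he
      have hi := (Finset.mem_filter.1 hi).2
      have hj := (Finset.mem_filter.1 hj).2
      rcases lt_trichotomy i j with h | h | h
      · exact absurd he (aux i j h hi hj)
      · exact h
      · exact absurd he.symm (aux j i h hj hi)
  have : birkhoffSum f (Uᶜ.indicator fun _ => (1 : ℝ)) T x =
      ((Finset.range T).filter fun i => f^[i] x ∈ Uᶜ).card := by
    simp only [birkhoffSum, Set.indicator_apply, Finset.sum_boole]
  rw [this]
  exact_mod_cast hcard

/-- If the Birkhoff sums of `φ` grow uniformly on a set containing the nonwandering set, then they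
grow uniformly everywhere. -/
theorem exists_birkhoffSum_ge_of_nonwanderingSet [MeasurableSpace X] [BorelSpace X] {f : X → X}
    (hf : Continuous f) {φ : X → ℝ} (hφ : Continuous φ) {S : Set X} {γ C : ℝ} (hγ : 0 < γ)
    (hS : ∀ x ∈ S, ∀ n : ℕ, n * γ - C ≤ birkhoffSum f φ n x) (hΩ : nonwanderingSet f ⊆ S) :
    ∃ C', ∀ (x : X) (n : ℕ), n * (γ / 2) - C' ≤ birkhoffSum f φ n x := by
  obtain ⟨K, hK0, hK⟩ := exists_forall_abs_le hφ
  obtain ⟨N, hN⟩ := exists_nat_gt (max 0 (C / (γ / 2)))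
  have hN0 : 0 < N := by exact_mod_cast (le_max_left _ _).trans_lt hN
  have hNC := (le_max_right _ _).trans_lt hN
  rw [div_lt_iff₀ (by linarith)] at hNC
  have hcont : Continuous (birkhoffSum f φ N) := by
    unfold birkhoffSum
    exact continuous_finsetSum _ fun i _ => hφ.comp (hf.iterate i)
  -- `N` is so large that `N * γ - C > N * (γ / 2)`, hence `U` contains the nonwandering set. On `U`
  -- the time `N` is a good stopping time for `-φ` at rate `-γ / 2`.
  set U : Set X := {x | N * (γ / 2) < birkhoffSum f φ N x} with hU
  have hUo : IsOpen U := isOpen_lt continuous_const hcont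
  obtain ⟨P, hP⟩ := exists_birkhoffSum_indicator_le hUo (f := f) fun x hx => by
    have := hS x (hΩ hx) N
    simp only [hU, Set.mem_ofPred_eq]
    linarith
  have hb : BoundedSubadditive f (fun n => birkhoffSum f (-φ) n) K :=
    boundedSubadditive_birkhoffSum hf.measurable hφ.measurable.neg fun x => by simpa using hK x
  have hneg : ∀ n x, birkhoffSum f (-φ) n x = -birkhoffSum f φ n x := fun n x => by
    simp [birkhoffSum]
  refine ⟨(K + |-(γ / 2)|) * P + N * (K + |-(γ / 2)|), fun x n => ?_⟩
  have h1 := hb.le_add_birkhoffSum_indicator hK0.le (c := -(γ / 2)) (N := N) (A := Uᶜ)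
    (fun z hz => ⟨N, hN0, le_rfl, by
      have : N * (γ / 2) < birkhoffSum f φ N z := by simpa [hU] using hz
      simp only [hneg]
      linarith⟩) n x
  simp only [hneg] at h1
  have h2 : (K + |-(γ / 2)|) * birkhoffSum f (Uᶜ.indicator fun _ => (1 : ℝ)) n x ≤
      (K + |-(γ / 2)|) * P := by
    gcongr
    exact hP n x
  linarith

end Wandering

/-! ### The limsup condition on periodic orbits. -/

section PeriodicMeans

/-- On a periodic orbit the limsup of the Birkhoff averages is the mean over a period. -/
theorem mul_le_birkhoffSum_of_le_limsup {Y : Type*} {f : Y → Y} {φ : Y → ℝ} {lam : ℝ} {p : Y}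
    {N : ℕ} (hN : 1 ≤ N) (hp : f^[N] p = p)
    (h : (lam : EReal) ≤ limsup (fun k : ℕ ↦
      (((1 / (k : ℝ)) * ∑ i ∈ Finset.range k, φ (f^[i] p) : ℝ) : EReal)) atTop) :
    N * lam ≤ birkhoffSum f φ N p := by
  by_contra! hcon
  have hN0 : (0 : ℝ) < N := by exact_mod_cast hN
  set s := birkhoffSum f φ N p / N with hs
  have hsN : birkhoffSum f φ N p = N * s := by rw [hs]; field_simp
  have hsl : s < lam := by rw [hs, div_lt_iff₀ hN0]; linarith
  obtain ⟨d, hsd, hdl⟩ := exists_between hsl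
  -- `C` bounds the contribution of an incomplete period.
  obtain ⟨C, hC⟩ := ((Finset.range N).image fun r : ℕ => birkhoffSum f φ r p - r * s).exists_le
  obtain ⟨K, hK⟩ := exists_nat_gt (C / (d - s))
  rw [div_lt_iff₀ (by linarith)] at hK
  have hev : ∀ᶠ k : ℕ in atTop,
      (((1 / (k : ℝ)) * ∑ i ∈ Finset.range k, φ (f^[i] p) : ℝ) : EReal) ≤ (d : EReal) := by
    filter_upwards [eventually_ge_atTop (max K 1)] with k hk
    have hk0 : (0 : ℝ) < k := by exact_mod_cast (by omega : 0 < k)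
    have hkK : (K : ℝ) ≤ k := by exact_mod_cast (le_max_left _ _).trans hk
    rw [EReal.coe_le_coe_iff, one_div, ← div_eq_inv_mul, div_le_iff₀ hk0]
    change birkhoffSum f φ k p ≤ d * k
    have h1 := hC _ (Finset.mem_image_of_mem _ (Finset.mem_range.2 (Nat.mod_lt k hN)))
    have h2 : k / N * N + k % N = k := by rw [mul_comm]; exact Nat.div_add_mod k N
    have h3 := birkhoffSum_mul_of_iterate_eq (φ := φ) hp (k / N) (k % N)
    rw [h2, hsN] at h3
    have h4 : ((k / N : ℕ) : ℝ) * N + (k % N : ℕ) = k := by exact_mod_cast h2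
    rw [h3]
    have h5 : (k : ℝ) * s = ((k / N : ℕ) : ℝ) * (N * s) + (k % N : ℕ) * s := by rw [← h4]; ring
    have h6 : (K : ℝ) * (d - s) ≤ k * (d - s) := by
      have : 0 ≤ d - s := by linarith
      gcongr
    linarith
  have h7 : (lam : EReal) ≤ (d : EReal) := h.trans (limsup_le_of_le (by isBoundedDefault) hev)
  rw [EReal.coe_le_coe_iff] at h7
  linarith

end PeriodicMeans

/-! ### Co-norms of iterates as a subadditive cocycle. -/

section Iterates

variable {E : Type*} [NormedAddCommGroup E] [NormedSpace ℝ E]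
    {M : Type*} [TopologicalSpace M] [ChartedSpace E M]

theorem IsLocalDiffeomorph.iterate {f : M → M} (hf : IsLocalDiffeomorph 𝓘(ℝ, E) 𝓘(ℝ, E) 1 f)
    (n : ℕ) : IsLocalDiffeomorph 𝓘(ℝ, E) 𝓘(ℝ, E) 1 f^[n] := by
  induction n with
  | zero => exact (Diffeomorph.refl 𝓘(ℝ, E) M 1).isLocalDiffeomorph
  | succ n ih => exact fun x => (hf x).comp 𝓘(ℝ, E) M (ih (f x))

variable [Bundle.RiemannianBundle (fun x : M ↦ TangentSpace 𝓘(ℝ, E) x)]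
  [FiniteDimensional ℝ E] [Nontrivial E]

theorem log_conorm_add_ge {f : M → M} (hf : IsLocalDiffeomorph 𝓘(ℝ, E) 𝓘(ℝ, E) 1 f)
    (m n : ℕ) (x : M) :
    Real.log (conorm E f^[m] x) + Real.log (conorm E f^[n] (f^[m] x)) ≤
      Real.log (conorm E f^[m + n] x) := by
  have h1 := conorm_pos (hf.iterate m x)
  have h2 := conorm_pos (hf.iterate n (f^[m] x))
  rw [← Real.log_mul h1.ne' h2.ne', mul_comm, add_comm m n, Function.iterate_add]
  exact Real.log_le_log (mul_pos h2 h1) (conorm_comp_ge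
    ((hf.iterate n).mdifferentiable one_ne_zero) ((hf.iterate m).mdifferentiable one_ne_zero) x)

theorem birkhoffSum_log_conorm_le {f : M → M} (hf : IsLocalDiffeomorph 𝓘(ℝ, E) 𝓘(ℝ, E) 1 f)
    (n : ℕ) (x : M) :
    birkhoffSum f (fun x => Real.log (conorm E f x)) n x ≤ Real.log (conorm E f^[n] x) := by
  induction n with
  | zero =>
    rw [birkhoffSum_zero]
    refine Real.log_nonneg (le_conorm fun v => ?_)
    rw [Function.iterate_zero, mfderiv_id, one_mul]
    exact le_rfl
  | succ n ih =>
    rw [birkhoffSum_succ]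
    have := log_conorm_add_ge hf n 1 x
    rw [Function.iterate_one] at this
    linarith

/-- Lower bounds on the Birkhoff sums of the logarithmic co-norm give uniform expansion. -/
theorem expandsOnWith_of_birkhoffSum_ge {f : M → M}
    (hf : IsLocalDiffeomorph 𝓘(ℝ, E) 𝓘(ℝ, E) 1 f) {S : Set M} {γ C : ℝ}
    (hS : ∀ x ∈ S, ∀ n : ℕ,
      n * γ - C ≤ birkhoffSum f (fun x => Real.log (conorm E f x)) n x) :
    ExpandsOnWith E f S (Real.exp (-C)) γ := by
  intro x hx v k _
  refine le_trans ?_ (conorm_mul_norm_le f^[k] x v)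
  have h1 : Real.exp (k * γ - C) ≤ conorm E f^[k] x := by
    rw [← Real.exp_log (conorm_pos (hf.iterate k x))]
    exact Real.exp_le_exp.2 ((hS x hx k).trans (birkhoffSum_log_conorm_le hf k x))
  calc Real.exp (-C) * ‖v‖ * Real.exp (k * γ) = Real.exp (k * γ - C) * ‖v‖ := by
        rw [sub_eq_add_neg, Real.exp_add]; ring
    _ ≤ _ := mul_le_mul_of_nonneg_right h1 (norm_nonneg _)

theorem log_conorm_iterate_le {f : M → M} (hf : IsLocalDiffeomorph 𝓘(ℝ, E) 𝓘(ℝ, E) 1 f) {K : ℝ}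
    (hK : ∀ (x : M) (v : TangentSpace 𝓘(ℝ, E) x),
      ‖mfderiv 𝓘(ℝ, E) 𝓘(ℝ, E) f x v‖ ≤ Real.exp K * ‖v‖) (n : ℕ) (x : M) :
    Real.log (conorm E f^[n] x) ≤ n * K := by
  have hbound : ∀ (n : ℕ) (x : M) (v : TangentSpace 𝓘(ℝ, E) x),
      ‖mfderiv 𝓘(ℝ, E) 𝓘(ℝ, E) f^[n] x v‖ ≤ Real.exp (n * K) * ‖v‖ := by
    intro n
    induction n with
    | zero =>
      intro x v
      rw [Function.iterate_zero, mfderiv_id, Nat.cast_zero, zero_mul, Real.exp_zero, one_mul]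
      exact le_rfl
    | succ n ih =>
      intro x v
      rw [Function.iterate_succ, mfderiv_comp x ((hf.iterate n).mdifferentiable one_ne_zero (f x))
        (hf.mdifferentiable one_ne_zero x)]
      refine (ih (f x) (mfderiv 𝓘(ℝ, E) 𝓘(ℝ, E) f x v)).trans ?_
      calc _ ≤ Real.exp (n * K) * (Real.exp K * ‖v‖) :=
            mul_le_mul_of_nonneg_left (hK x v) (Real.exp_nonneg _)
        _ = _ := by
          rw [← mul_assoc, ← Real.exp_add]
          congr 2
          push_cast
          ring
  have : Nontrivial (TangentSpace 𝓘(ℝ, E) x) := inferInstanceAs (Nontrivial E)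
  obtain ⟨v, hv⟩ := exists_norm_eq (TangentSpace 𝓘(ℝ, E) x) zero_le_one
  have h1 := (conorm_mul_norm_le f^[n] x v).trans (hbound n x v)
  rw [hv, mul_one, mul_one] at h1
  rw [Real.log_le_iff_le_exp (conorm_pos (hf.iterate n x))]
  exact h1

variable [IsManifold 𝓘(ℝ, E) 1 M]
  [IsContinuousRiemannianBundle E (fun x : M ↦ TangentSpace 𝓘(ℝ, E) x)] [CompactSpace M]
  [MeasurableSpace M] [BorelSpace M]

theorem exists_boundedSubadditive_neg_log_conorm {f : M → M}
    (hf : IsLocalDiffeomorph 𝓘(ℝ, E) 𝓘(ℝ, E) 1 f) :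
    ∃ K ≥ 0, BoundedSubadditive f (fun n x => -Real.log (conorm E f^[n] x)) K := by
  obtain ⟨K₁, hK₁, h1⟩ := exists_norm_mfderiv_le hf.contMDiff
  obtain ⟨K₂, hK₂, h2⟩ := exists_forall_abs_le (continuous_log_conorm hf)
  have hmeas : ∀ n, Measurable fun x => Real.log (conorm E f^[n] x) := fun n =>
    (continuous_log_conorm (hf.iterate n)).measurable
  refine ⟨max K₁ K₂, by positivity, fun n => (hmeas n).neg, fun m n x => ?_, fun n x => ?_⟩
  · have := log_conorm_add_ge hf m n x
    linarith
  · rw [abs_neg, abs_le]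
    constructor
    · have h3 := neg_le_of_abs_le ((boundedSubadditive_birkhoffSum hf.contMDiff.continuous.measurable
        (continuous_log_conorm hf).measurable h2).abs_le n x)
      have h4 := birkhoffSum_log_conorm_le hf n x
      have h5 : (n : ℝ) * K₂ ≤ n * max K₁ K₂ := by gcongr; exact le_max_right _ _
      linarith
    · refine (log_conorm_iterate_le hf h1 n x).trans ?_
      gcongr
      exact le_max_left _ _

end Iterates

/-! ### The main theorem. -/

theorem theorem1
    {E : Type*} [NormedAddCommGroup E] [NormedSpace ℝ E] [FiniteDimensional ℝ E] [Nontrivial E]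
    {M : Type*} [TopologicalSpace M] [T2Space M] [CompactSpace M]
    [ChartedSpace E M] [IsManifold 𝓘(ℝ, E) ∞ M]
    [Bundle.RiemannianBundle (fun x : M ↦ TangentSpace 𝓘(ℝ, E) x)]
    [IsContinuousRiemannianBundle E (fun x : M ↦ TangentSpace 𝓘(ℝ, E) x)]
    [MeasurableSpace M] [BorelSpace M]
    (f : M → M) (hsurj : Function.Surjective f)
    (hf : IsLocalDiffeomorph 𝓘(ℝ, E) 𝓘(ℝ, E) 1 f)
    (hexp : NonuniformlyExpandingOn E f (Function.periodicPts f)) :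
    (∃ C lam : ℝ, 0 < C ∧ 0 < lam ∧
      ExpandsOnWith E f (closure (Function.periodicPts f)) C lam ∧
      ∀ μ : Measure M, IsProbabilityMeasure μ → Ergodic f μ →
        ∃ L : ℝ, IsMinLyapunovExponent E f μ L ∧
          (L ≤ 0 ∨ (lam ≤ L ∧ μ.support ⊆ closure (Function.periodicPts f)))) ∧
    (nonwanderingSet f ⊆ closure (Function.periodicPts f) →
      UniformlyExpandingOn E f Set.univ) := by
  have : IsManifold 𝓘(ℝ, E) 1 M := IsManifold.of_le (n := ∞) (by norm_cast)
  -- The distance is extended because `M` need not be connected.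
  let : EMetricSpace M := EMetricSpace.ofRiemannianMetric 𝓘(ℝ, E) M
  have : IsRiemannianManifold 𝓘(ℝ, E) M := ⟨fun _ _ => rfl⟩
  have hfc : Continuous f := hf.contMDiff.continuous
  have hφ : Continuous fun x => Real.log (conorm E f x) := continuous_log_conorm hf
  have hbr : ∀ n : ℕ, HasUniformInverseBranches f^[n] fun x => Real.log (conorm E f^[n] x) :=
    fun n => hasUniformInverseBranches_log_conorm (hf.iterate n)
  obtain ⟨lam, hlam, hlim⟩ := hexp
  have hper : ∀ p N, 1 ≤ N → f^[N] p = p →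
      N * lam ≤ birkhoffSum f (fun x => Real.log (conorm E f x)) N p := fun p N hN hp =>
    mul_le_birkhoffSum_of_le_limsup hN hp (hlim p ⟨N, hN, hp⟩)
  obtain ⟨C, hC⟩ := (hbr 1).exists_birkhoffSum_ge hφ (half_pos hlam) (half_lt_self hlam) hper
  have hcl : ∀ x ∈ closure (Function.periodicPts f), ∀ n : ℕ,
      n * (lam / 2) - C ≤ birkhoffSum f (fun x => Real.log (conorm E f x)) n x := by
    intro x hx n
    have hcont : Continuous (birkhoffSum f (fun x => Real.log (conorm E f x)) n) :=
      continuous_finsetSum _ fun i _ => hφ.comp (hfc.iterate i)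
    exact closure_minimal (fun y hy => hC y hy n) (isClosed_le continuous_const hcont) hx
  refine ⟨⟨Real.exp (-C), lam / 2, Real.exp_pos _, half_pos hlam,
    expandsOnWith_of_birkhoffSum_ge hf hcl, fun μ _ hμ => ?_⟩, fun hΩ => ?_⟩
  · obtain ⟨K, hK, hsub⟩ := exists_boundedSubadditive_neg_log_conorm hf
    obtain ⟨L, hL, happrox⟩ := hsub.exists_ae_tendsto hμ hK
    have hexpo : IsMinLyapunovExponent E f μ (-L) := by
      filter_upwards [hL] with x hx
      simpa using hx.neg
    refine ⟨-L, hexpo, ?_⟩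
    rcases le_or_gt (-L) 0 with h0 | h0
    · exact Or.inl h0
    -- The exponent is `-L > 0`, so some `m` has negative mean of `-log ‖Df^m‖_co`.
    obtain ⟨m, hm, hmint⟩ := happrox 0 (by linarith)
    rw [mul_zero, integral_neg] at hmint
    have hsupp : μ.support ⊆ closure (Function.periodicPts f) :=
      (hbr m).support_subset_closure_periodicPts hfc hμ hm
        (continuous_log_conorm (hf.iterate m)) (by linarith)
    refine Or.inr ⟨?_, hsupp⟩
    obtain ⟨x, hx, hxs⟩ := (hexpo.and (Measure.support_mem_ae (μ := μ))).exists
    have hlow : Tendsto (fun n : ℕ => lam / 2 - C / (n : ℝ)) atTop (𝓝 (lam / 2)) := by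
      simpa using (tendsto_const_div_atTop_nhds_zero_nat C).const_sub (lam / 2)
    refine le_of_tendsto_of_tendsto hlow hx ?_
    filter_upwards [eventually_ge_atTop 1] with n hn
    have hn0 : (0 : ℝ) < n := by exact_mod_cast hn
    have h1 := (hcl x (hsupp hxs) n).trans (birkhoffSum_log_conorm_le hf n x)
    rw [one_div, ← div_eq_inv_mul, le_div_iff₀ hn0, sub_mul, div_mul_cancel₀ C hn0.ne']
    linarith
  · obtain ⟨C', hC'⟩ := exists_birkhoffSum_ge_of_nonwanderingSet hfc hφ (half_pos hlam) hcl hΩ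
    exact ⟨Real.exp (-C'), lam / 2 / 2, Real.exp_pos _, by positivity,
      expandsOnWith_of_birkhoffSum_ge hf fun x _ n => hC' x n⟩
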